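/- Let $\phi,\psi$ be real polynomials of degree at most $2$ such that, on $[0,1]$, $\phi$ is concave with $\phi(0)=\phi(1)=0$, $-1<\phi'(1)<0$, and $\psi$ is convex with $\psi(1)=0$, $\psi'(1)<0$, $\psi''(1)-\phi''(1)>0$. Let $(w,\kappa)$ be a solution of $$\frac{\partial w}{\partial t}(x,t)+[\phi(x)-\kappa(t)\psi(x)]\frac{\partial w}{\partial x}(x,t)=w(x,t),\qquad \int_0^1 w(x,t)\,dx=1,\qquad 0\le x<1,\ t\ge 0,$$ where $\kappa$ is continuous on $[0,\infty)$, $w$ is continuous on $[0,1)\times[0,\infty)$, the differential equation is understood along characteristics (if $X'(s)=\phi(X(s))-\kappa(s)\psi(X(s))$ with $X(s)\in[0,1)$, then $\frac{d}{ds}w(X(s),s)=w(X(s),s)$), and the initial datum is strictly positive on $[0,1)$ and of the form $w(x,0)=\int_x^1c_0(y)\,dy$ with $c_0\ge 0$ integrable on $(0,1)$. For a profile $w$ on $[0,1)$ of this form its beta function is $$\beta(x)=\frac{c(x)\,h(x)}{w(x)^2},\qquad c=-w',\quad h(x)=\int_x^1 w(y)\,dy,$$ defined for almost every $x\in(0,1)$;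 let $\beta(\cdot,t)$ be the beta function of $w(\cdot,t)$. Assume that $\beta(\cdot,0)$ is Hölder continuous at $x=1$ with $\beta(1,0)=\beta_0\in(0,1)$, i.e. there are constants $K$ and $\alpha>0$ with $|\beta(x,0)-\beta_0|\le K(1-x)^\alpha$ for almost every $x\in(0,1)$. Set $$\kappa_\infty=\frac{1/\beta_0-\phi'(1)-1}{|\psi'(1)|}.$$ Then the system has exactly one time-independent solution $w_{\kappa_\infty}$ with constant parameter $\kappa_\infty$, and, if $\beta_{\kappa_\infty}$ denotes its beta function, there are constants $C,\gamma>0$ such that for all $t\ge 0$ $$|\kappa(t)-\kappa_\infty|\le Ce^{-\gamma t},\qquad \|\beta(\cdot,t)-\beta_{\kappa_\infty}\|_{L^\infty(0,1)}\le Ce^{-\gamma t}.$$ -/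

import Mathlib

open MeasureTheory Set Polynomial

/-- The coefficient functions `φ, ψ` of the quadratic model: real polynomials of degree at most
two, considered on `[0,1]`, with `φ` concave, `φ(0) = φ(1) = 0`, `-1 < φ'(1) < 0`, and `ψ` convex,
`ψ(1) = 0`, `ψ'(1) < 0`, `ψ''(1) - φ''(1) > 0`. -/
structure QuadraticCoefficients (φ ψ : ℝ[X]) : Prop where
  natDegree_phi : φ.natDegree ≤ 2
  natDegree_psi : ψ.natDegree ≤ 2
  concave_phi : ConcaveOn ℝ (Icc 0 1) (fun x : ℝ => φ.eval x)
  phi_zero : φ.eval 0 = 0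
  phi_one : φ.eval 1 = 0
  neg_one_lt : -1 < φ.derivative.eval 1
  deriv_phi_neg : φ.derivative.eval 1 < 0
  convex_psi : ConvexOn ℝ (Icc 0 1) (fun x : ℝ => ψ.eval x)
  psi_one : ψ.eval 1 = 0
  deriv_psi_neg : ψ.derivative.eval 1 < 0
  second_deriv_pos : 0 < ψ.derivative.derivative.eval 1 - φ.derivative.derivative.eval 1

/-- Admissible initial profiles on `[0,1)`: `w₀(x) = ∫_x^1 c₀` for some nonnegative integrable
density `c₀` on `(0,1)`, and `w₀` is strictly positive on `[0,1)`.  In particular `w₀` is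
decreasing on `[0,1)` and tends to `0` at `1`. -/
structure IsInitialProfile (w₀ : ℝ → ℝ) : Prop where
  exists_density : ∃ c₀ : ℝ → ℝ, IntegrableOn c₀ (Ioo 0 1) ∧ (∀ x ∈ Ioo (0 : ℝ) 1, 0 ≤ c₀ x) ∧
    ∀ x ∈ Ico (0 : ℝ) 1, w₀ x = ∫ y in x..1, c₀ y
  pos : ∀ x ∈ Ico (0 : ℝ) 1, 0 < w₀ x

/-- `X` is a characteristic curve, over the time interval `[t₁, t₂]` and inside `[0,1)`, of the
vector field `φ(x) - κ(t) ψ(x)`. -/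
def IsCharacteristic (φ ψ κ X : ℝ → ℝ) (t₁ t₂ : ℝ) : Prop :=
  ∀ s ∈ Icc t₁ t₂, X s ∈ Ico (0 : ℝ) 1 ∧
    HasDerivWithinAt X (φ (X s) - κ s * ψ (X s)) (Icc t₁ t₂) s

/-- `(w, κ)` solves on `[0,1) × [0,∞)` the system
`∂w/∂t + [φ(x) - κ(t) ψ(x)] ∂w/∂x = w`, `∫₀¹ w(x,t) dx = 1`.
The profiles are only absolutely continuous in `x`, so the first-order operator
`∂/∂t + [φ - κ ψ] ∂/∂x` is the derivative along its characteristic curves: along every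
characteristic the function `w` is differentiable, with derivative `w`.  (For differentiable `w`
this follows from the pointwise equation by the chain rule.)  No boundary value is imposed at
`x = 0`, and no sign is imposed on `κ`. -/
structure IsSolution (φ ψ : ℝ → ℝ) (w : ℝ → ℝ → ℝ) (κ : ℝ → ℝ) : Prop where
  initial : IsInitialProfile (fun x => w x 0)
  continuousOn_kappa : ContinuousOn κ (Ici 0)
  continuousOn_w : ContinuousOn (fun q : ℝ × ℝ => w q.1 q.2) (Ico 0 1 ×ˢ Ici 0)
  transport : ∀ (X : ℝ → ℝ) (t₁ t₂ : ℝ), 0 ≤ t₁ → IsCharacteristic φ ψ κ X t₁ t₂ →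
    ∀ s ∈ Icc t₁ t₂, HasDerivWithinAt (fun r => w (X r) r) (w (X s) s) (Icc t₁ t₂) s
  mass : ∀ t : ℝ, 0 ≤ t → ∫ x in (0 : ℝ)..1, w x t = 1

/-- `W` is a time-independent solution with (constant) parameter `κ`. -/
def IsStationarySolution (φ ψ : ℝ → ℝ) (κ : ℝ) (W : ℝ → ℝ) : Prop :=
  IsSolution φ ψ (fun x _ => W x) (fun _ => κ)

/-- The beta function `c h / w²` of a profile `w` on `[0,1)`, where `c = -w'` and
`h(x) = ∫_x^1 w`.  For `w(x) = ∫_x^1 c`, with `c` integrable, it is defined for almost all `x`. -/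
noncomputable def betaFn (w : ℝ → ℝ) (x : ℝ) : ℝ :=
  -deriv w x * (∫ y in x..1, w y) / w x ^ 2

/-- The function `f` on `[0,1)` (defined almost everywhere) is Hölder continuous at `x = 1`, with
value `b` there. -/
def HolderAtOne (f : ℝ → ℝ) (b : ℝ) : Prop :=
  ∃ K α : ℝ, 0 < α ∧
    ∀ᵐ x ∂(volume.restrict (Ioo (0 : ℝ) 1)), |f x - b| ≤ K * (1 - x) ^ α

/-!
The coefficients are explicit in the coordinate `y = 1 - x`: `φ = a y - a y²` and `ψ = b y + q y²`,
with `a, b > 0` and `q ≥ 0`. The characteristics solve the Riccati equation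
`y' = (b κ - a) y + (a + q κ) y²`, so the point `y` at time `t` comes from its Möbius image
`y / (s t + r t * y)`, where `s` and `r` solve linear equations (`IsRiccatiFlow`). Hence
`w (1 - y, t) = eᵗ g (y / (s t + r t * y))` with the initial profile `g`, as long as no
characteristic has entered at `x = 0`.

*Sign of `κ`.* Differentiating `∫ w = 1` gives the balance
`eᵗ ((b κ - a) S₁ + (a + q κ) S₂) = 1`, with `S₁ ≥ S₂ ≥ 0` the moments `∫ y dg` and `∫ y² dg` of the
transported profile, and the balance forces `κ > 0`. It holds at time `0` without any information
about the inflow (`IsSolution.balance_zero`), and then at a hypothetical first zero of `κ`. So `κ`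
stays positive (`IsSolution.kappa_pos`) and the transport formula holds at all times.

*Behaviour of the initial profile at the boundary.* The quotient `ρ = (∫₀ᶻ g) / g` satisfies
`ρ' = 1 - β`. Hölder continuity of `β` at the boundary therefore gives `z g' / g = p + O(z^α)` with
`p = β₀ / (1 - β₀)` (`BoundaryProfile.exists_abs_logDeriv_le`), and the ratios of `g` agree with
those of `z ^ p` up to factors `exp (O(z^α))`.

*Convergence.* Conservation of mass forces the visible part `[0, 1 / (s + r)]` of the initial
profile to shrink like `exp (-t / p)`. The shape of the transported profile depends on `F = r / s`,
for which the balance gives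
`F' = (A P + Q - F) / D`, `Q = q / b`, `A = a (1 + Q)`, with `P → p` exponentially fast and `D`
positive and bounded. So `F → A p + Q` and `b κ - a → 1 / p` exponentially fast
(`IsTransported.exists_convergence`). Finally the beta function at time `t` differs by
`O((s + r) ^ (-α))` from that of `(y / (1 + F y)) ^ p`, which is Lipschitz in `F`, and for
`F = A p + Q` this power is, up to normalization, the stationary profile. It is the only one,
because the characteristic through `x = 0` sweeps the whole interval.
-/

/-! ### Absolutely continuous functions and Möbius substitutions -/

open Filter Topology in
lemma AbsolutelyContinuousOnInterval.lipschitzOnWith_comp {f Φ : ℝ → ℝ} {a b : ℝ} {K : NNReal}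
    {S : Set ℝ} (hΦ : LipschitzOnWith K Φ S) (hf : AbsolutelyContinuousOnInterval f a b)
    (hS : MapsTo f (uIcc a b) S) :
    AbsolutelyContinuousOnInterval (fun x => Φ (f x)) a b := by
  rw [absolutelyContinuousOnInterval_iff] at hf ⊢
  intro ε hε
  obtain ⟨δ, hδ, H⟩ := hf (ε / (K + 1)) (by positivity)
  refine ⟨δ, hδ, fun E hE hEδ => ?_⟩
  have h1 := H E hE hEδ
  calc ∑ i ∈ Finset.range E.1, dist (Φ (f (E.2 i).1)) (Φ (f (E.2 i).2))
      ≤ ∑ i ∈ Finset.range E.1, K * dist (f (E.2 i).1) (f (E.2 i).2) :=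
        Finset.sum_le_sum fun i hi =>
          hΦ.dist_le_mul (f (E.2 i).1) (hS (hE.1 i hi).1) (f (E.2 i).2) (hS (hE.1 i hi).2)
    _ = K * ∑ i ∈ Finset.range E.1, dist (f (E.2 i).1) (f (E.2 i).2) := by
        rw [Finset.mul_sum]
    _ ≤ (K + 1) * ∑ i ∈ Finset.range E.1, dist (f (E.2 i).1) (f (E.2 i).2) := by
        gcongr
        linarith
    _ < (K + 1) * (ε / (K + 1)) := by gcongr
    _ = ε := by field_simp

lemma AbsolutelyContinuousOnInterval.contDiffOn_comp {f Φ : ℝ → ℝ} {a b c d : ℝ}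
    (hΦ : ContDiffOn ℝ 1 Φ (Icc c d)) (hf : AbsolutelyContinuousOnInterval f a b)
    (hS : MapsTo f (uIcc a b) (Icc c d)) :
    AbsolutelyContinuousOnInterval (fun x => Φ (f x)) a b := by
  obtain ⟨K, hK⟩ := hΦ.exists_lipschitzOnWith (by decide) (convex_Icc c d) isCompact_Icc
  exact hf.lipschitzOnWith_comp hK hS

lemma AbsolutelyContinuousOnInterval.abs_sub_le_integral {f k : ℝ → ℝ} {a b : ℝ} (hab : a ≤ b)
    (hf : AbsolutelyContinuousOnInterval f a b) (hk : IntervalIntegrable k volume a b)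
    (hfk : ∀ᵐ x, x ∈ Ioo a b → |deriv f x| ≤ k x) :
    |f b - f a| ≤ ∫ x in a..b, k x := by
  rw [← hf.integral_deriv_eq_sub, ← Real.norm_eq_abs]
  refine intervalIntegral.norm_integral_le_of_norm_le hab ?_ hk
  have hb : ∀ᵐ x : ℝ, x ≠ b := by simp [ae_iff, measure_singleton]
  filter_upwards [hfk, hb] with x hx hxb hxm
  exact hx ⟨hxm.1, lt_of_le_of_ne hxm.2 hxb⟩

/-- Leibniz rule for `(u, v) ↦ ∫₀ᵘ g(z) / (1 - v z)² dz`, below the singularity `z = 1 / v`. -/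
lemma hasFDerivAt_kernel_integral {g : ℝ → ℝ} (hg : Continuous g) {u v : ℝ} (hu : 0 < u)
    (huv : v * u < 1) :
    HasFDerivAt (fun x : ℝ × ℝ => ∫ z in (0 : ℝ)..x.1, g z / (1 - x.2 * z) ^ 2)
      ((ContinuousLinearMap.toSpanSingleton ℝ (g u / (1 - v * u) ^ 2)).coprod
        (ContinuousLinearMap.toSpanSingleton ℝ (∫ z in (0 : ℝ)..u, 2 * z * g z / (1 - v * z) ^ 3)))
      (u, v) := by
  -- Clamping the denominator from below by `δ` makes all integrands continuous on the whole line
  -- and changes nothing on a neighbourhood `O` of `(u, v)`.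
  obtain ⟨δ, hδ0, hδ1, hδ⟩ : ∃ δ : ℝ, 0 < δ ∧ δ < 1 ∧ v * u < 1 - δ := by
    refine ⟨min ((1 - v * u) / 2) (1 / 2), by rw [lt_min_iff]; constructor <;> linarith, ?_, ?_⟩
    · exact (min_le_right _ _).trans_lt (by norm_num)
    · linarith [min_le_left ((1 - v * u) / 2) (1 / 2)]
  set O : Set (ℝ × ℝ) := {x | 0 < x.1 ∧ x.2 * x.1 < 1 - δ} with hO
  have hOo : IsOpen O :=
    (isOpen_lt continuous_const continuous_fst).inter
      (isOpen_lt (continuous_snd.mul continuous_fst) continuous_const)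
  have hmem : O ∈ nhds (u, v) := hOo.mem_nhds ⟨hu, hδ⟩
  set k : ℝ → ℝ → ℝ := fun w z => max (1 - w * z) δ with hk
  have hk0 : ∀ w z, 0 < k w z := fun w z => lt_of_lt_of_le hδ0 (le_max_right _ _)
  have hkδ : ∀ w z, δ ≤ k w z := fun w z => le_max_right _ _
  have hlt : ∀ x w z : ℝ, 0 < x → w * x < 1 - δ → z ∈ Icc 0 x → δ < 1 - w * z := by
    intro x w z hx hwx hz
    rcases le_or_gt w 0 with hw | hw
    · nlinarith [mul_nonneg (neg_nonneg.2 hw) hz.1]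
    · nlinarith [mul_le_mul_of_nonneg_left hz.2 hw.le]
  have hkeq : ∀ x w z : ℝ, 0 < x → w * x < 1 - δ → z ∈ Icc 0 x → k w z = 1 - w * z :=
    fun x w z hx hwx hz => max_eq_left (hlt x w z hx hwx hz).le
  have hkc : Continuous (fun x : ℝ × ℝ => k x.1 x.2) := by simp only [hk]; fun_prop
  have hkc' : ∀ w, Continuous (k w) := fun w => by simp only [hk]; fun_prop
  have hc1 : ∀ w, Continuous (fun z => g z / k w z ^ 2) := fun w =>
    hg.div ((hkc' w).pow 2) fun z => (pow_pos (hk0 w z) 2).ne'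
  have hc2 : ∀ w, Continuous (fun z => 2 * z * g z / k w z ^ 3) := fun w =>
    (by fun_prop : Continuous fun z => 2 * z * g z).div ((hkc' w).pow 3)
      fun z => (pow_pos (hk0 w z) 3).ne'
  have key := hasStrictFDerivAt_uncurry_coprod (𝕜 := ℝ) (u := (u, v))
    (f := fun x w => ∫ z in (0 : ℝ)..x, g z / k w z ^ 2)
    (f₁ := fun x w => ContinuousLinearMap.toSpanSingleton ℝ (g x / k w x ^ 2))
    (f₂ := fun x w => ContinuousLinearMap.toSpanSingleton ℝ
      (∫ z in (0 : ℝ)..x, 2 * z * g z / k w z ^ 3)) ?_ ?_ ?_ ?_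
  · have h2 := key.hasFDerivAt
    have e1 : k v u = 1 - v * u := hkeq u v u hu hδ ⟨hu.le, le_rfl⟩
    have e2 : (∫ z in (0 : ℝ)..u, 2 * z * g z / k v z ^ 3)
        = ∫ z in (0 : ℝ)..u, 2 * z * g z / (1 - v * z) ^ 3 := by
      refine intervalIntegral.integral_congr fun z hz => ?_
      rw [uIcc_of_le hu.le] at hz
      simp only [hkeq u v z hu hδ hz]
    simp only [Function.HasUncurry.uncurry, id, e1, e2] at h2
    refine h2.congr_of_eventuallyEq ?_
    filter_upwards [hmem] with x hx
    refine intervalIntegral.integral_congr fun z hz => ?_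
    rw [uIcc_of_le hx.1.le] at hz
    simp only [hkeq x.1 x.2 z hx.1 hx.2 hz]
  · refine Filter.Eventually.of_forall fun x => ?_
    exact (intervalIntegral.integral_hasDerivAt_right ((hc1 x.2).intervalIntegrable _ _)
      ((hc1 x.2).stronglyMeasurableAtFilter _ _) (hc1 x.2).continuousAt).hasFDerivAt
  · filter_upwards [hmem] with x hx
    refine HasDerivAt.hasFDerivAt ?_
    have hS : {w : ℝ | w * x.1 < 1 - δ} ∈ nhds x.2 :=
      (isOpen_lt (continuous_id.mul continuous_const) continuous_const).mem_nhds hx.2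
    refine (intervalIntegral.hasDerivAt_integral_of_dominated_loc_of_deriv_le
      (F := fun w z => g z / k w z ^ 2) (F' := fun w z => 2 * z * g z / k w z ^ 3)
      (bound := fun z => |2 * z * g z| / δ ^ 3) hS
      (Filter.Eventually.of_forall fun w => (hc1 w).aestronglyMeasurable)
      ((hc1 _).intervalIntegrable _ _) (hc2 _).aestronglyMeasurable
      (Filter.Eventually.of_forall fun z _ w _ => ?_)
      (Continuous.intervalIntegrable (by fun_prop) _ _)
      (Filter.Eventually.of_forall fun z hz w hw => ?_)).2
    · rw [Real.norm_eq_abs, abs_div, abs_of_pos (pow_pos (hk0 w z) 3)]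
      gcongr
      exact hkδ w z
    · rw [uIoc_of_le hx.1.le] at hz
      have hz' : z ∈ Icc 0 x.1 := ⟨hz.1.le, hz.2⟩
      have hne : 1 - w * z ≠ 0 := (hδ0.trans (hlt _ _ _ hx.1 hw hz')).ne'
      have hd : HasDerivAt (fun w => g z / (1 - w * z) ^ 2) (2 * z * g z / (1 - w * z) ^ 3) w := by
        have h1 : HasDerivAt (fun w : ℝ => 1 - w * z) (-z) w := by
          simpa using ((hasDerivAt_id w).mul_const z).const_sub 1
        refine ((hasDerivAt_const w (g z)).div (h1.pow 2) (pow_ne_zero 2 hne)).congr_deriv ?_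
        simp only [Pi.pow_apply]
        rw [div_eq_div_iff (by positivity) (by positivity)]
        push_cast
        ring
      rw [hkeq _ _ _ hx.1 hw hz']
      refine hd.congr_of_eventuallyEq ?_
      have hS' : {w : ℝ | w * x.1 < 1 - δ} ∈ nhds w :=
        (isOpen_lt (continuous_id.mul continuous_const) continuous_const).mem_nhds hw
      filter_upwards [hS'] with w' hw'
      rw [hkeq _ _ _ hx.1 hw' hz']
  · have : Continuous fun x : ℝ × ℝ => g x.1 / k x.2 x.1 ^ 2 :=
      (hg.comp continuous_fst).div ((hkc.comp continuous_swap).pow 2)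
        fun x => (pow_pos (hk0 _ _) 2).ne'
    exact ((ContinuousLinearMap.toSpanSingletonCLE (𝕜 := ℝ) (E := ℝ)).continuous.comp
      this).continuousAt
  · have h3 : Continuous (Function.uncurry fun (x : ℝ × ℝ) (z : ℝ) =>
        2 * z * g z / k x.2 z ^ 3) :=
      Continuous.div (by fun_prop) ((hkc.comp (by fun_prop :
        Continuous fun y : (ℝ × ℝ) × ℝ => (y.1.2, y.2))).pow 3) fun x => (pow_pos (hk0 _ _) 3).ne'
    have : Continuous fun x : ℝ × ℝ => ∫ z in (0 : ℝ)..x.1, 2 * z * g z / k x.2 z ^ 3 :=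
      intervalIntegral.continuous_parametric_intervalIntegral_of_continuous h3 continuous_fst
    exact ((ContinuousLinearMap.toSpanSingletonCLE (𝕜 := ℝ) (E := ℝ)).continuous.comp
      this).continuousAt

section Moebius

variable {s r : ℝ}

/-- For `y ∈ [0, 1]` the denominator `s + r y` is positive, being a convex combination of `s` and
`s + r`. -/
lemma moebius_denom_pos (hs : 0 < s) (hsr : 0 < s + r) {y : ℝ} (hy : y ∈ Icc (0 : ℝ) 1) :
    0 < s + r * y := by
  rcases eq_or_lt_of_le hy.1 with h | h
  · rw [← h]; linarith
  · nlinarith [mul_nonneg hs.le (sub_nonneg.2 hy.2), mul_pos hsr h]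

lemma moebius_inv_denom_pos (hs : 0 < s) (hsr : 0 < s + r) {z : ℝ} (hz : z ∈ Icc 0 (1 / (s + r))) :
    0 < 1 - r * z := by
  have h1 : (s + r) * z ≤ 1 := by
    have := mul_le_mul_of_nonneg_left hz.2 hsr.le
    rwa [mul_one_div_cancel hsr.ne'] at this
  rcases eq_or_lt_of_le hz.1 with h | h
  · rw [← h]; simp
  · nlinarith [mul_pos hs h]

lemma hasDerivAt_moebius (y : ℝ) (h : s + r * y ≠ 0) :
    HasDerivAt (fun y => y / (s + r * y)) (s / (s + r * y) ^ 2) y := by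
  have h1 : HasDerivAt (fun y : ℝ => s + r * y) r y := by
    simpa using ((hasDerivAt_id y).const_mul r).const_add s
  refine ((hasDerivAt_id y).div h1 h).congr_deriv ?_
  simp only [id]
  congr 1
  ring

lemma hasDerivAt_moebius_inv (z : ℝ) (h : 1 - r * z ≠ 0) :
    HasDerivAt (fun z => s * z / (1 - r * z)) (s / (1 - r * z) ^ 2) z := by
  have h1 : HasDerivAt (fun z : ℝ => 1 - r * z) (-r) z := by
    simpa using ((hasDerivAt_id z).const_mul r).const_sub 1
  refine (((hasDerivAt_id z).const_mul s).div h1 h).congr_deriv ?_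
  simp only [id]
  congr 1
  ring

/-- Substitution `z = y / (s + r y)`. -/
lemma integral_comp_moebius (hs : 0 < s) (hsr : 0 < s + r) {g : ℝ → ℝ} (hg : Continuous g) :
    ∫ y in (0 : ℝ)..1, g (y / (s + r * y)) =
      ∫ z in (0 : ℝ)..1 / (s + r), s * (g z / (1 - r * z) ^ 2) := by
  have hm : 0 < 1 / (s + r) := by positivity
  have hpos : ∀ z ∈ uIcc 0 (1 / (s + r)), 0 < 1 - r * z := fun z hz =>
    moebius_inv_denom_pos hs hsr (by rwa [uIcc_of_le hm.le] at hz)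
  set Y : ℝ → ℝ := fun z => s * z / (1 - r * z) with hY
  have hYc : ContinuousOn Y (uIcc 0 (1 / (s + r))) := fun z hz =>
    (hasDerivAt_moebius_inv z (hpos z hz).ne').continuousAt.continuousWithinAt
  have hone : 1 - r * (1 / (s + r)) = s / (s + r) := by field_simp; ring
  have hY1 : Y (1 / (s + r)) = 1 := by
    simp only [hY]
    rw [hone]
    field_simp
  have himg : Y '' uIcc 0 (1 / (s + r)) ⊆ Icc 0 1 := by
    rintro _ ⟨z, hz, rfl⟩
    have h0 := hpos z hz
    rw [uIcc_of_le hm.le] at hz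
    have h1 : (s + r) * z ≤ 1 := by
      have := mul_le_mul_of_nonneg_left hz.2 hsr.le
      rwa [mul_one_div_cancel hsr.ne'] at this
    refine ⟨div_nonneg (mul_nonneg hs.le hz.1) h0.le, ?_⟩
    simp only [hY]
    rw [div_le_one h0]
    linarith
  have h := intervalIntegral.integral_comp_mul_deriv' (a := 0) (b := 1 / (s + r)) (f := Y)
    (f' := fun z => s / (1 - r * z) ^ 2) (g := fun y => g (y / (s + r * y)))
    (fun z hz => hasDerivAt_moebius_inv z (hpos z hz).ne')
    (ContinuousOn.div (by fun_prop) (by fun_prop) fun z hz => (pow_pos (hpos z hz) 2).ne')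
    ?_
  · have hY0 : Y 0 = 0 := by simp [hY]
    rw [hY0, hY1] at h
    rw [← h]
    refine intervalIntegral.integral_congr fun z hz => ?_
    have h0 := hpos z hz
    have h2 : Y z / (s + r * Y z) = z := by
      have : s + r * Y z = s / (1 - r * z) := by simp only [hY]; field_simp; ring
      rw [this]
      simp only [hY]
      rw [div_div_div_cancel_right₀ h0.ne', mul_div_cancel_left₀ _ hs.ne']
    simp only [Function.comp, h2]
    ring
  · refine ContinuousOn.mono (s := Icc 0 1) ?_ himg
    refine hg.comp_continuousOn (ContinuousOn.div (by fun_prop) (by fun_prop) fun y hy => ?_)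
    exact (moebius_denom_pos hs hsr hy).ne'

/-- Integration by parts against powers of the inverse Möbius map, which is `1` at the upper end
point; the cases `n = 0, 1` occur in the derivative of the mass. -/
lemma integral_by_parts_moebius (hs : 0 < s) (hsr : 1 ≤ s + r) {g : ℝ → ℝ}
    (hac : AbsolutelyContinuousOnInterval g 0 1) (n : ℕ) :
    ∫ z in (0 : ℝ)..1 / (s + r), g z *
        ((n + 1 : ℕ) * (s * z / (1 - r * z)) ^ n * (s / (1 - r * z) ^ 2)) =
      g (1 / (s + r)) -
        ∫ z in (0 : ℝ)..1 / (s + r), deriv g z * (s * z / (1 - r * z)) ^ (n + 1) := by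
  have hsr0 : 0 < s + r := by linarith
  have hm : 0 < 1 / (s + r) := by positivity
  have hm1 : 1 / (s + r) ≤ 1 := by rw [div_le_one hsr0]; exact hsr
  have hpos : ∀ z ∈ uIcc 0 (1 / (s + r)), 0 < 1 - r * z := fun z hz =>
    moebius_inv_denom_pos hs hsr0 (by rwa [uIcc_of_le hm.le] at hz)
  have hac' : AbsolutelyContinuousOnInterval g 0 (1 / (s + r)) :=
    hac.mono (by rw [uIcc_of_le hm.le, uIcc_of_le zero_le_one]; exact Icc_subset_Icc_right hm1)
  have hd : ∀ z ∈ uIcc 0 (1 / (s + r)), HasDerivAt (fun z => (s * z / (1 - r * z)) ^ (n + 1))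
      ((n + 1 : ℕ) * (s * z / (1 - r * z)) ^ n * (s / (1 - r * z) ^ 2)) z := fun z hz =>
    (hasDerivAt_moebius_inv z (hpos z hz).ne').pow (n + 1)
  have hY : AbsolutelyContinuousOnInterval (fun z => (s * z / (1 - r * z)) ^ (n + 1)) 0
      (1 / (s + r)) := by
    refine ContDiffOn.absolutelyContinuousOnInterval ?_
    exact (ContDiffOn.div (by fun_prop) (by fun_prop) fun z hz => (hpos z hz).ne').pow (n + 1)
  have hone : 1 - r * (1 / (s + r)) = s / (s + r) := by field_simp; ring
  have hY1 : s * (1 / (s + r)) / (1 - r * (1 / (s + r))) = 1 := by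
    rw [hone]
    field_simp
  have h := hac'.integral_mul_deriv_eq_deriv_mul hY
  rw [hY1] at h
  simp only [one_pow, mul_one, mul_zero, zero_div, ne_eq, Nat.add_eq_zero_iff, one_ne_zero,
    and_false, not_false_eq_true, zero_pow, sub_zero] at h
  rw [← h]
  refine intervalIntegral.integral_congr fun z hz => ?_
  rw [(hd z hz).deriv]

end Moebius

/-- The `n`-th moment `∫₀¹ yⁿ dg(y / (s + r y))` of the profile transported by the Möbius map,
written in the coordinate `z = y / (s + r y)` of the original profile. -/
noncomputable def moebiusMoment (g : ℝ → ℝ) (s r : ℝ) (n : ℕ) : ℝ :=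
  ∫ z in (0 : ℝ)..1 / (s + r), deriv g z * (s * z / (1 - r * z)) ^ n

/-- Derivative of the mass of a profile transported by a moving Möbius map. -/
lemma hasDerivAt_integral_comp_moebius {g : ℝ → ℝ} (hg : Continuous g)
    (hac : AbsolutelyContinuousOnInterval g 0 1) {s r : ℝ → ℝ} {s' r' t : ℝ}
    (hs : HasDerivAt s s' t) (hr : HasDerivAt r r' t) (hs0 : 0 < s t) (hsr : 1 ≤ s t + r t) :
    HasDerivAt (fun τ => ∫ y in (0 : ℝ)..1, g (y / (s τ + r τ * y)))
      (-(s' / s t) * moebiusMoment g (s t) (r t) 1 - r' / s t * moebiusMoment g (s t) (r t) 2)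
      t := by
  have hsr0 : 0 < s t + r t := by linarith
  have hm : 0 < 1 / (s t + r t) := by positivity
  have hone : 1 - r t * (1 / (s t + r t)) = s t / (s t + r t) := by field_simp; ring
  have hlt : r t * (1 / (s t + r t)) < 1 := by
    have : 0 < s t / (s t + r t) := by positivity
    linarith
  have hK := hasFDerivAt_kernel_integral hg hm hlt
  have hu : HasDerivAt (fun τ => 1 / (s τ + r τ)) (-(s' + r') / (s t + r t) ^ 2) t := by
    refine ((hasDerivAt_const t (1 : ℝ)).div (hs.add hr) hsr0.ne').congr_deriv ?_
    simp
  have hcomp := hs.mul (hK.comp_hasDerivAt (f := fun τ => (1 / (s τ + r τ), r τ)) t (hu.prodMk hr))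
  have hev : (fun τ => ∫ y in (0 : ℝ)..1, g (y / (s τ + r τ * y))) =ᶠ[nhds t]
      (s * ((fun x : ℝ × ℝ => ∫ z in (0 : ℝ)..x.1, g z / (1 - x.2 * z) ^ 2) ∘
        fun τ => (1 / (s τ + r τ), r τ))) := by
    filter_upwards [hs.continuousAt.eventually_const_lt hs0,
      (hs.continuousAt.add hr.continuousAt).eventually_const_lt hsr0] with τ h1 h2
    rw [integral_comp_moebius h1 h2 hg, intervalIntegral.integral_const_mul]
    rfl
  refine (hcomp.congr_of_eventuallyEq hev).congr_deriv ?_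
  have e1 := integral_by_parts_moebius hs0 hsr hac 0
  have e2 := integral_by_parts_moebius hs0 hsr hac 1
  rw [zero_add] at e1
  rw [one_add_one_eq_two] at e2
  have f1 : ∫ z in (0 : ℝ)..1 / (s t + r t), g z / (1 - r t * z) ^ 2 =
      (1 / s t) * (g (1 / (s t + r t)) - moebiusMoment g (s t) (r t) 1) := by
    rw [moebiusMoment, ← e1, ← intervalIntegral.integral_const_mul]
    refine intervalIntegral.integral_congr fun z _ => ?_
    simp
    field_simp
  have f2 : ∫ z in (0 : ℝ)..1 / (s t + r t), 2 * z * g z / (1 - r t * z) ^ 3 =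
      (1 / s t ^ 2) * (g (1 / (s t + r t)) - moebiusMoment g (s t) (r t) 2) := by
    rw [moebiusMoment, ← e2, ← intervalIntegral.integral_const_mul]
    refine intervalIntegral.integral_congr fun z hz => ?_
    rw [uIcc_of_le hm.le] at hz
    have := moebius_inv_denom_pos hs0 hsr0 hz
    simp
    field_simp
  simp only [Function.comp, ContinuousLinearMap.coprod_apply,
    ContinuousLinearMap.toSpanSingleton_apply, smul_eq_mul, f1, f2, hone]
  field_simp
  ring

/-! ### Profiles at the boundary point -/

/-- A profile in the boundary coordinate `y = 1 - x`, extended to the whole line: nondecreasing,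
absolutely continuous on `[0, 1]`, vanishing at `0` and positive to the right of `0`. -/
structure BoundaryProfile (g : ℝ → ℝ) : Prop where
  continuous : Continuous g
  monotone : Monotone g
  ac : AbsolutelyContinuousOnInterval g 0 1
  zero : g 0 = 0
  pos : ∀ z, 0 < z → 0 < g z

lemma IsInitialProfile.exists_boundaryProfile {w₀ : ℝ → ℝ} (h : IsInitialProfile w₀) :
    ∃ g, BoundaryProfile g ∧ ∀ y ∈ Ioc (0 : ℝ) 1, w₀ (1 - y) = g y := by
  obtain ⟨c₀, hint, hnn, hw⟩ := h.exists_density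
  set c : ℝ → ℝ := (Ioo (0 : ℝ) 1).indicator c₀ with hc
  have hci : Integrable c := (integrable_indicator_iff measurableSet_Ioo).2 hint
  have hc0 : ∀ x, 0 ≤ c x := fun x => indicator_nonneg hnn x
  set d : ℝ → ℝ := fun u => c (1 - u) with hd
  have hdi : Integrable d := hci.comp_sub_left 1
  have hval : ∀ y ∈ Ioc (0 : ℝ) 1, w₀ (1 - y) = ∫ u in (0 : ℝ)..y, d u := by
    intro y hy
    rw [hw (1 - y) ⟨by linarith [hy.2], by linarith [hy.1]⟩]
    simp only [hd]
    rw [intervalIntegral.integral_comp_sub_left (fun u => c u) 1, sub_zero]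
    refine intervalIntegral.integral_congr_ae ?_
    have hb : ∀ᵐ x : ℝ, x ≠ 1 := by simp [ae_iff, measure_singleton]
    filter_upwards [hb] with x hx hxm
    rw [uIoc_of_le (by linarith [hy.1])] at hxm
    have hx' : x ∈ Ioo (0 : ℝ) 1 := ⟨by linarith [hxm.1, hy.2], lt_of_le_of_ne hxm.2 hx⟩
    simp only [hc, indicator_of_mem hx']
  have hmono : Monotone fun z => ∫ u in (0 : ℝ)..z, d u := by
    intro z z' hzz
    have h1 := intervalIntegral.integral_add_adjacent_intervals (μ := volume) (f := d) (a := 0)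
      (b := z) (c := z') hdi.intervalIntegrable hdi.intervalIntegrable
    have h2 : 0 ≤ ∫ u in z..z', d u :=
      intervalIntegral.integral_nonneg hzz fun u _ => hc0 _
    simp only
    linarith
  have hpos1 : ∀ y ∈ Ioc (0 : ℝ) 1, 0 < ∫ u in (0 : ℝ)..y, d u := fun y hy => by
    rw [← hval y hy]
    exact h.pos _ ⟨by linarith [hy.2], by linarith [hy.1]⟩
  refine ⟨fun z => ∫ u in (0 : ℝ)..z, d u, ⟨?_, hmono, ?_, by simp, ?_⟩, hval⟩
  · exact intervalIntegral.continuous_primitive (fun a b => hdi.intervalIntegrable) 0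
  · exact hdi.intervalIntegrable.absolutelyContinuousOnInterval_intervalIntegral (by simp)
  · intro z hz
    rcases le_or_gt z 1 with h1 | h1
    · exact hpos1 z ⟨hz, h1⟩
    · exact (hpos1 1 ⟨one_pos, le_rfl⟩).trans_le (hmono h1.le)

namespace BoundaryProfile

variable {g : ℝ → ℝ}

lemma nonneg (hg : BoundaryProfile g) {z : ℝ} (hz : 0 ≤ z) : 0 ≤ g z := by
  rw [← hg.zero]; exact hg.monotone hz

lemma integral_pos (hg : BoundaryProfile g) {z : ℝ} (hz : 0 < z) : 0 < ∫ u in (0 : ℝ)..z, g u :=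
  intervalIntegral.intervalIntegral_pos_of_pos_on (hg.continuous.intervalIntegrable _ _)
    (fun u hu => hg.pos u hu.1) hz

lemma integral_le (hg : BoundaryProfile g) {z : ℝ} (hz : 0 ≤ z) :
    ∫ u in (0 : ℝ)..z, g u ≤ z * g z := by
  have := intervalIntegral.integral_mono_on hz (hg.continuous.intervalIntegrable 0 z)
    (intervalIntegrable_const (c := g z) (μ := volume)) fun u hu => hg.monotone hu.2
  simpa using this

lemma hasDerivAt_integral (hg : BoundaryProfile g) (z : ℝ) :
    HasDerivAt (fun z => ∫ u in (0 : ℝ)..z, g u) (g z) z :=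
  intervalIntegral.integral_hasDerivAt_right (hg.continuous.intervalIntegrable _ _)
    (hg.continuous.stronglyMeasurableAtFilter _ _) hg.continuous.continuousAt

lemma ac_mono (hg : BoundaryProfile g) {a b : ℝ} (ha : 0 ≤ a) (hab : a ≤ b) (hb : b ≤ 1) :
    AbsolutelyContinuousOnInterval g a b :=
  hg.ac.mono (by
    rw [uIcc_of_le hab, uIcc_of_le zero_le_one]
    exact Icc_subset_Icc ha hb)

lemma mapsTo (hg : BoundaryProfile g) {a b : ℝ} (hab : a ≤ b) :
    MapsTo g (uIcc a b) (Icc (g a) (g b)) := fun z hz => by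
  rw [uIcc_of_le hab] at hz
  exact ⟨hg.monotone hz.1, hg.monotone hz.2⟩

lemma ae_differentiableAt (hg : BoundaryProfile g) :
    ∀ᵐ z, z ∈ Ioo (0 : ℝ) 1 → DifferentiableAt ℝ g z := by
  filter_upwards [hg.ac.ae_differentiableAt] with z hz hm
  exact hz (by rw [uIcc_of_le zero_le_one]; exact Ioo_subset_Icc_self hm)

/-- The quotient `ρ = (∫₀ᶻ g) / g(z)` satisfies `ρ' = 1 - β` and `ρ(0+) = 0`, so it is asymptotically
linear at `0`, with slope `1 - β(0)`. -/
lemma abs_integral_div_sub_le (hg : BoundaryProfile g) {b K α : ℝ} (hK : 0 ≤ K) (hα : 0 < α)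
    (hβ : ∀ᵐ z, z ∈ Ioo (0 : ℝ) 1 →
      |deriv g z * (∫ u in (0 : ℝ)..z, g u) / g z ^ 2 - b| ≤ K * z ^ α)
    {z : ℝ} (hz : z ∈ Ioc (0 : ℝ) 1) :
    |(∫ u in (0 : ℝ)..z, g u) / g z - (1 - b) * z| ≤ K * z ^ α * z := by
  set H : ℝ → ℝ := fun z => ∫ u in (0 : ℝ)..z, g u with hH
  set ρ : ℝ → ℝ := fun z => H z * (g z)⁻¹ with hρ
  have hz0 := hz.1
  -- the estimate between `ε` and `z`
  have hε : ∀ ε ∈ Ioo 0 z, |(ρ z - (1 - b) * z) - (ρ ε - (1 - b) * ε)| ≤ K * z ^ α * (z - ε) := by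
    intro ε hε
    have hac : AbsolutelyContinuousOnInterval g ε z := hg.ac_mono hε.1.le hε.2.le hz.2
    have hgε := hg.pos ε hε.1
    have hinv : AbsolutelyContinuousOnInterval (fun z => (g z)⁻¹) ε z := by
      refine hac.contDiffOn_comp (Φ := fun x => x⁻¹) (c := g ε) (d := g z) ?_ (hg.mapsTo hε.2.le)
      exact contDiffOn_id.inv fun x hx => (hgε.trans_le hx.1).ne'
    have hHac : AbsolutelyContinuousOnInterval H ε z := by
      refine ContDiffOn.absolutelyContinuousOnInterval (ContDiff.contDiffOn ?_)
      refine contDiff_one_iff_deriv.2 ⟨fun x => (hg.hasDerivAt_integral x).differentiableAt, ?_⟩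
      have : deriv H = g := funext fun x => (hg.hasDerivAt_integral x).deriv
      rw [this]
      exact hg.continuous
    have hlin : AbsolutelyContinuousOnInterval (fun z => (1 - b) * z) ε z :=
      ContDiffOn.absolutelyContinuousOnInterval (by fun_prop)
    have hf := (hHac.fun_mul hinv).fun_sub hlin
    refine (hf.abs_sub_le_integral hε.2.le (k := fun _ => K * z ^ α)
      intervalIntegrable_const ?_).trans ?_
    · filter_upwards [hβ, hg.ae_differentiableAt] with x hx hdx hxm
      have hx1 : x ∈ Ioo (0 : ℝ) 1 := ⟨hε.1.trans hxm.1, hxm.2.trans_le hz.2⟩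
      have hgx := hg.pos x hx1.1
      have hd : HasDerivAt (fun z => H z * (g z)⁻¹ - (1 - b) * z)
          (g x * (g x)⁻¹ + H x * (-deriv g x / g x ^ 2) - (1 - b) * 1) x :=
        ((hg.hasDerivAt_integral x).mul ((hdx hx1).hasDerivAt.inv hgx.ne')).sub
          ((hasDerivAt_id x).const_mul (1 - b))
      rw [hd.deriv]
      have e : g x * (g x)⁻¹ + H x * (-deriv g x / g x ^ 2) - (1 - b) * 1
          = -(deriv g x * H x / g x ^ 2 - b) := by
        rw [mul_inv_cancel₀ hgx.ne']; ring
      rw [e, abs_neg]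
      refine (hx hx1).trans ?_
      gcongr
      · exact hx1.1.le
      · exact hxm.2.le
    · rw [intervalIntegral.integral_const, smul_eq_mul, mul_comm]
  have hbound : ∀ ε ∈ Ioo 0 z, |ρ z - (1 - b) * z| ≤ K * z ^ α * z + (1 + |1 - b|) * ε := by
    intro ε he
    have h1 := hε ε he
    have hgε := hg.pos ε he.1
    have h2 : 0 ≤ ρ ε := mul_nonneg (hg.integral_pos he.1).le (inv_nonneg.2 hgε.le)
    have h3 : ρ ε ≤ ε := by
      simp only [hρ]
      rw [← div_eq_mul_inv, div_le_iff₀ hgε]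
      exact hg.integral_le he.1.le
    have h4 : |ρ ε - (1 - b) * ε| ≤ (1 + |1 - b|) * ε := by
      refine (abs_sub _ _).trans ?_
      rw [abs_mul (1 - b), abs_of_nonneg h2, abs_of_pos he.1]
      linarith
    have h5 := abs_sub_abs_le_abs_sub (ρ z - (1 - b) * z) (ρ ε - (1 - b) * ε)
    have h6 : K * z ^ α * (z - ε) ≤ K * z ^ α * z := by
      have : 0 ≤ K * z ^ α := by positivity
      nlinarith [he.1]
    linarith
  have hlim : Filter.Tendsto (fun ε => K * z ^ α * z + (1 + |1 - b|) * ε) (nhdsWithin 0 (Ioi 0))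
      (nhds (K * z ^ α * z)) := by
    have : ContinuousAt (fun ε : ℝ => K * z ^ α * z + (1 + |1 - b|) * ε) 0 := by fun_prop
    have h := this.tendsto.mono_left (nhdsWithin_le_nhds (s := Ioi 0))
    simpa using h
  have := ge_of_tendsto hlim (by
    filter_upwards [Ioo_mem_nhdsGT hz0] with ε he using hbound ε he)
  simpa only [hρ, ← div_eq_mul_inv] using this

/-- If the beta function is Hölder continuous at the boundary, with value `b`, then the profile
behaves there like the power with exponent `b / (1 - b)`, in the sense of its logarithmic
derivative. -/
lemma exists_abs_logDeriv_le (hg : BoundaryProfile g) {b K α : ℝ} (hb0 : 0 < b) (hb1 : b < 1)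
    (hα : 0 < α)
    (hβ : ∀ᵐ z, z ∈ Ioo (0 : ℝ) 1 →
      |deriv g z * (∫ u in (0 : ℝ)..z, g u) / g z ^ 2 - b| ≤ K * z ^ α) :
    ∃ L, 0 < L ∧ ∀ᵐ z, z ∈ Ioo (0 : ℝ) 1 →
      |z * deriv g z - b / (1 - b) * g z| ≤ L * z ^ α * g z := by
  wlog hK : 0 < K generalizing K
  · refine this (K := 1) ?_ one_pos
    filter_upwards [hβ] with z hz hm
    have := Real.rpow_nonneg hm.1.le α
    refine (hz hm).trans ?_
    nlinarith
  set H : ℝ → ℝ := fun z => ∫ u in (0 : ℝ)..z, g u with hH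
  set p := b / (1 - b) with hp
  have h1b : 0 < 1 - b := by linarith
  have hp0 : 0 < p := by positivity
  have hρ : ∀ z ∈ Ioc (0 : ℝ) 1, |H z / g z - (1 - b) * z| ≤ K * z ^ α * z :=
    fun z hz => hg.abs_integral_div_sub_le hK.le hα hβ hz
  -- a linear lower bound for `ρ = H / g`, near `0` by the asymptotics and elsewhere by monotonicity
  obtain ⟨d, hd0, hd⟩ : ∃ d, 0 < d ∧ ∀ z ∈ Ioc (0 : ℝ) 1, d * z ≤ H z / g z := by
    set z₀ : ℝ := min 1 (((1 - b) / (2 * K)) ^ (1 / α)) with hz₀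
    have hz₀0 : 0 < z₀ := lt_min one_pos (by positivity)
    have hz₀α : K * z₀ ^ α ≤ (1 - b) / 2 := by
      have h1 : z₀ ^ α ≤ (1 - b) / (2 * K) := by
        calc z₀ ^ α ≤ (((1 - b) / (2 * K)) ^ (1 / α)) ^ α :=
              Real.rpow_le_rpow hz₀0.le (min_le_right _ _) hα.le
          _ = (1 - b) / (2 * K) := by
              rw [← Real.rpow_mul (by positivity), one_div_mul_cancel hα.ne', Real.rpow_one]
      calc K * z₀ ^ α ≤ K * ((1 - b) / (2 * K)) := by gcongr
        _ = (1 - b) / 2 := by field_simp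
    have hH0 := hg.integral_pos hz₀0
    have hg1 := hg.pos 1 one_pos
    refine ⟨min ((1 - b) / 2) (H z₀ / g 1), lt_min (by positivity) (div_pos hH0 hg1), ?_⟩
    intro z hz
    rcases le_or_gt z z₀ with h | h
    · have h1 := (abs_le.1 (hρ z hz)).1
      have h2 : K * z ^ α ≤ (1 - b) / 2 := by
        refine le_trans ?_ hz₀α
        gcongr
        exact hz.1.le
      have h3 := mul_le_mul_of_nonneg_right h2 hz.1.le
      have h4 := mul_le_mul_of_nonneg_right (min_le_left ((1 - b) / 2) (H z₀ / g 1)) hz.1.le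
      linarith
    · have hmono : H z₀ ≤ H z := by
        have h1 := intervalIntegral.integral_add_adjacent_intervals (μ := volume) (f := g)
          (a := 0) (b := z₀) (c := z) (hg.continuous.intervalIntegrable _ _)
          (hg.continuous.intervalIntegrable _ _)
        have h2 : 0 ≤ ∫ u in z₀..z, g u :=
          intervalIntegral.integral_nonneg h.le fun u hu => hg.nonneg (hz₀0.le.trans hu.1)
        simp only [hH]
        linarith
      calc min ((1 - b) / 2) (H z₀ / g 1) * z ≤ H z₀ / g 1 * 1 :=
            mul_le_mul (min_le_right _ _) hz.2 hz.1.le (div_pos hH0 hg1).le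
        _ ≤ H z / g z := by
            rw [mul_one]
            exact div_le_div₀ (hH0.le.trans hmono) hmono (hg.pos z hz.1) (hg.monotone hz.2)
  refine ⟨K * (1 + p) / d, by positivity, ?_⟩
  filter_upwards [hβ] with z hz hm
  have hm' : z ∈ Ioc (0 : ℝ) 1 := ⟨hm.1, hm.2.le⟩
  have hgz := hg.pos z hm.1
  have hHz := hg.integral_pos hm.1
  have hz1 := hz hm
  have hz2 := hρ z hm'
  have hz3 := hd z hm'
  set β := deriv g z * H z / g z ^ 2 with hβz
  set ρ := H z / g z with hρz
  have hρ0 : 0 < ρ := div_pos hHz hgz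
  -- `z g' / g = z β / ρ`
  have e1 : z * deriv g z - p * g z = (z * (β - b) - p * (ρ - (1 - b) * z)) / ρ * g z := by
    have hpb : p * (1 - b) = b := by rw [hp]; field_simp
    have : z * (β - b) - p * (ρ - (1 - b) * z) = z * β - p * ρ := by
      linear_combination z * hpb
    have hH0 : H z ≠ 0 := hHz.ne'
    rw [this, hβz, hρz]
    field_simp
  rw [e1, abs_mul, abs_of_pos hgz, abs_div, abs_of_pos hρ0]
  gcongr
  rw [div_le_iff₀ hρ0]
  have h5 : |z * (β - b) - p * (ρ - (1 - b) * z)| ≤ z * (K * z ^ α) + p * (K * z ^ α * z) := by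
    refine (abs_sub _ _).trans ?_
    rw [abs_mul, abs_mul, abs_of_pos hm.1, abs_of_pos hp0]
    have := hm.1.le
    gcongr
  refine h5.trans ?_
  calc z * (K * z ^ α) + p * (K * z ^ α * z) = K * (1 + p) / d * z ^ α * (d * z) := by
        field_simp
    _ ≤ K * (1 + p) / d * z ^ α * ρ := by
        have := Real.rpow_nonneg hm.1.le α
        gcongr

/-- The integrated form of a bound on the logarithmic derivative. -/
lemma abs_log_div_sub_le (hg : BoundaryProfile g) {p L α : ℝ} (hα : 0 < α) (hL : 0 < L)
    (hlog : ∀ᵐ z, z ∈ Ioo (0 : ℝ) 1 → |z * deriv g z - p * g z| ≤ L * z ^ α * g z)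
    {u z : ℝ} (hu : 0 < u) (huz : u ≤ z) (hz : z ≤ 1) :
    |Real.log (g z / g u) - p * Real.log (z / u)| ≤ L / α * z ^ α := by
  have hz0 := hu.trans_le huz
  have hgu := hg.pos u hu
  have hgz := hg.pos z hz0
  have hac : AbsolutelyContinuousOnInterval (fun x => Real.log (g x)) u z := by
    refine (hg.ac_mono hu.le huz hz).contDiffOn_comp (Φ := Real.log) (c := g u) (d := g z) ?_
      (hg.mapsTo huz)
    exact contDiffOn_id.log fun x hx => (hgu.trans_le hx.1).ne'
  have hlogac : AbsolutelyContinuousOnInterval (fun x => p * Real.log x) u z := by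
    refine AbsolutelyContinuousOnInterval.const_mul p
      (ContDiffOn.absolutelyContinuousOnInterval (contDiffOn_id.log fun x hx => ?_))
    rw [uIcc_of_le huz] at hx
    exact (hu.trans_le hx.1).ne'
  have hki : IntervalIntegrable (fun x : ℝ => L * x ^ (α - 1)) volume u z :=
    (intervalIntegral.intervalIntegrable_rpow' (by linarith)).const_mul L
  have h := (hac.fun_sub hlogac).abs_sub_le_integral huz hki ?_
  · rw [Real.log_div hgz.ne' hgu.ne', Real.log_div hz0.ne' hu.ne']
    rw [intervalIntegral.integral_const_mul, integral_rpow (Or.inl (by linarith)),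
      sub_add_cancel] at h
    have e : Real.log (g z) - Real.log (g u) - p * (Real.log z - Real.log u)
        = Real.log (g z) - p * Real.log z - (Real.log (g u) - p * Real.log u) := by ring
    rw [e]
    refine h.trans ?_
    have := Real.rpow_nonneg hu.le α
    calc L * ((z ^ α - u ^ α) / α) ≤ L * (z ^ α / α) := by gcongr; linarith
      _ = L / α * z ^ α := by ring
  · filter_upwards [hlog, hg.ae_differentiableAt] with x hx hdx hxm
    have hx1 : x ∈ Ioo (0 : ℝ) 1 := ⟨hu.trans hxm.1, hxm.2.trans_le hz⟩
    have hgx := hg.pos x hx1.1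
    have hd : HasDerivAt (fun x => Real.log (g x) - p * Real.log x)
        (deriv g x / g x - p * x⁻¹) x :=
      ((hdx hx1).hasDerivAt.log hgx.ne').sub ((Real.hasDerivAt_log hx1.1.ne').const_mul p)
    rw [hd.deriv]
    have e : deriv g x / g x - p * x⁻¹ = (x * deriv g x - p * g x) / (x * g x) := by
      have := hx1.1.ne'
      field_simp
    have hxp := mul_pos hx1.1 hgx
    rw [e, abs_div, abs_of_pos hxp, div_le_iff₀ hxp, Real.rpow_sub_one hx1.1.ne']
    refine (hx hx1).trans (le_of_eq ?_)
    have := hx1.1.ne'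
    field_simp

end BoundaryProfile

/-! ### The characteristic flow and the sign of the parameter -/

/-- The characteristic flow of the quadratic model. In the coordinate `y = 1 - x` the
characteristics solve the Riccati equation `y' = (b κ - a) y + (a + q κ) y²`, so that `1 / y` solves
a linear equation; the point at `y` at time `t` started at the Möbius image `y / (s t + r t * y)`,
where `s` and `r` are as follows. -/
structure IsRiccatiFlow (a b q : ℝ) (κ s r : ℝ → ℝ) : Prop where
  s_zero : s 0 = 1
  r_zero : r 0 = 0
  s_pos : ∀ t, 0 < s t
  hasDerivAt_s : ∀ t, 0 ≤ t → HasDerivAt s ((b * κ t - a) * s t) t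
  hasDerivAt_r : ∀ t, 0 ≤ t → HasDerivAt r ((a + q * κ t) * s t) t

lemma exists_isRiccatiFlow (a b q : ℝ) {κ : ℝ → ℝ} (hκ : ContinuousOn κ (Ici 0)) :
    ∃ s r, IsRiccatiFlow a b q κ s r := by
  set k : ℝ → ℝ := fun t => κ (max t 0) with hk
  have hkc : Continuous k :=
    hκ.comp_continuous (by fun_prop) fun t => le_max_right t 0
  have hkκ : ∀ t, 0 ≤ t → k t = κ t := fun t ht => by simp [hk, ht]
  have hA : ∀ t, HasDerivAt (fun t => ∫ u in (0 : ℝ)..t, (b * k u - a)) (b * k t - a) t :=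
    fun t => intervalIntegral.integral_hasDerivAt_right
      (Continuous.intervalIntegrable (by fun_prop) _ _)
      (Continuous.stronglyMeasurableAtFilter (by fun_prop) _ _)
      (Continuous.continuousAt (by fun_prop))
  set s : ℝ → ℝ := fun t => Real.exp (∫ u in (0 : ℝ)..t, (b * k u - a)) with hs
  have hsd : ∀ t, HasDerivAt s ((b * k t - a) * s t) t := fun t => by
    rw [mul_comm]; exact (hA t).exp
  have hsc : Continuous s := continuous_iff_continuousAt.2 fun t => (hsd t).continuousAt
  refine ⟨s, fun t => ∫ u in (0 : ℝ)..t, (a + q * k u) * s u, by simp [hs], by simp,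
    fun t => Real.exp_pos _, fun t ht => hkκ t ht ▸ hsd t, fun t ht => ?_⟩
  rw [← hkκ t ht]
  exact intervalIntegral.integral_hasDerivAt_right
      (Continuous.intervalIntegrable (by fun_prop) _ _)
      (Continuous.stronglyMeasurableAtFilter (by fun_prop) _ _)
      (Continuous.continuousAt (by fun_prop))

/-- The two coefficient functions in the coordinate `y = 1 - x`. -/
structure IsModel (a b q : ℝ) (φ ψ : ℝ → ℝ) : Prop where
  phi_eq : ∀ y, φ (1 - y) = a * y - a * y ^ 2
  psi_eq : ∀ y, ψ (1 - y) = b * y + q * y ^ 2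
  a_pos : 0 < a
  b_pos : 0 < b
  q_nonneg : 0 ≤ q

section Transport

variable {a b q : ℝ} {φ ψ : ℝ → ℝ} {w : ℝ → ℝ → ℝ} {κ s r g : ℝ → ℝ}

/-- Transport along the characteristic that ends in `(1 - y, t)`. The hypothesis says that this
characteristic has stayed in the domain since time `0`. -/
lemma IsSolution.eq_exp_mul (hw : IsSolution φ ψ w κ) (hM : IsModel a b q φ ψ)
    (hf : IsRiccatiFlow a b q κ s r) {t y : ℝ} (ht : 0 ≤ t) (hy : 0 < y)
    (hin : ∀ τ ∈ Icc 0 t, s τ + r τ ≤ s t / y + r t) :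
    y / (s t + r t * y) ∈ Ioc (0 : ℝ) 1 ∧
      w (1 - y) t = Real.exp t * w (1 - y / (s t + r t * y)) 0 := by
  set U₀ : ℝ := s t / y + r t with hU₀
  have hU₀1 : 1 ≤ U₀ := by
    have := hin 0 ⟨le_rfl, ht⟩
    rwa [hf.s_zero, hf.r_zero, add_zero] at this
  have hU₀p : 0 < U₀ := by linarith
  have hz : y / (s t + r t * y) = 1 / U₀ := by
    have : s t + r t * y = U₀ * y := by rw [hU₀]; field_simp
    rw [this]; field_simp
  rw [hz]
  refine ⟨⟨by positivity, by rw [div_le_one hU₀p]; exact hU₀1⟩, ?_⟩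
  -- the reciprocal distance to the boundary point `x = 1`, along the characteristic
  set U : ℝ → ℝ := fun τ => (U₀ - r τ) / s τ with hU
  have hU1 : ∀ τ ∈ Icc 0 t, 1 ≤ U τ := fun τ hτ => by
    simp only [hU]
    rw [le_div_iff₀ (hf.s_pos τ)]
    linarith [hin τ hτ]
  set X : ℝ → ℝ := fun τ => 1 - (U τ)⁻¹ with hX
  have hXd : ∀ τ ∈ Icc 0 t, HasDerivAt X (φ (X τ) - κ τ * ψ (X τ)) τ := by
    intro τ hτ
    have h1 := hU1 τ hτ
    have hsτ := hf.s_pos τ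
    have hUd : HasDerivAt U (-(a + q * κ τ) - (b * κ τ - a) * U τ) τ := by
      refine (((hf.hasDerivAt_r τ hτ.1).const_sub U₀).div (hf.hasDerivAt_s τ hτ.1)
        hsτ.ne').congr_deriv ?_
      simp only [hU]
      field_simp
    refine ((hUd.inv (by linarith)).const_sub 1).congr_deriv ?_
    simp only [hX]
    rw [hM.phi_eq, hM.psi_eq]
    have : U τ ≠ 0 := by linarith
    field_simp
    ring
  have hchar : IsCharacteristic φ ψ κ X 0 t := fun τ hτ => by
    have h1 := hU1 τ hτ
    refine ⟨⟨?_, ?_⟩, (hXd τ hτ).hasDerivWithinAt⟩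
    · simp only [hX, sub_nonneg]
      exact inv_le_one_of_one_le₀ h1
    · simp only [hX]
      have : 0 < (U τ)⁻¹ := inv_pos.2 (by linarith)
      linarith
  have htr := hw.transport X 0 t le_rfl hchar
  have hexp : ∀ τ, HasDerivAt (fun τ : ℝ => Real.exp (-τ)) (-Real.exp (-τ)) τ := fun τ => by
    simpa using (hasDerivAt_neg τ).exp
  have hfd : ∀ τ ∈ Icc 0 t, HasDerivWithinAt (fun τ => Real.exp (-τ) * w (X τ) τ) 0 (Icc 0 t) τ := by
    intro τ hτ
    refine ((hexp τ).hasDerivWithinAt.mul (htr τ hτ)).congr_deriv ?_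
    ring
  have hconst := constant_of_derivWithin_zero (f := fun τ => Real.exp (-τ) * w (X τ) τ) (a := 0)
    (b := t) (fun τ hτ => (hfd τ hτ).differentiableWithinAt) (fun τ hτ => by
      have hτ' := Ico_subset_Icc_self hτ
      exact (hfd τ hτ').derivWithin ((uniqueDiffOn_Icc (hτ.1.trans_lt hτ.2)) τ hτ'))
    t ⟨ht, le_rfl⟩
  have hXt : X t = 1 - y := by
    simp only [hX, hU, hU₀]
    have := (hf.s_pos t).ne'
    rw [add_sub_cancel_right, div_div_cancel_left' this, inv_inv]
  have hX0 : X 0 = 1 - 1 / U₀ := by simp [hX, hU, hf.s_zero, hf.r_zero]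
  simp only [hXt, hX0, neg_zero, Real.exp_zero, one_mul] at hconst
  rw [← hconst, ← mul_assoc, ← Real.exp_add, add_neg_cancel, Real.exp_zero, one_mul]

/-- As long as the outermost characteristic leaves the domain monotonically, the solution is
transported from its initial value. -/
lemma IsSolution.eq_exp_mul_profile (hw : IsSolution φ ψ w κ) (hM : IsModel a b q φ ψ)
    (hf : IsRiccatiFlow a b q κ s r) (hg0 : ∀ y ∈ Ioc (0 : ℝ) 1, w (1 - y) 0 = g y)
    {t y : ℝ} (ht : 0 ≤ t) (hin : ∀ τ ∈ Icc 0 t, s τ + r τ ≤ s t + r t) (hy : y ∈ Ioc (0 : ℝ) 1) :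
    w (1 - y) t = Real.exp t * g (y / (s t + r t * y)) := by
  have h := hw.eq_exp_mul hM hf ht hy.1 fun τ hτ => (hin τ hτ).trans (by
    gcongr
    rw [le_div_iff₀ hy.1]
    nlinarith [hf.s_pos t, hy.2])
  rw [h.2, hg0 _ h.1]

/-- The mass at time `t` of the transported profile. -/
noncomputable def transportedMass (g s r : ℝ → ℝ) (t : ℝ) : ℝ :=
  Real.exp t * ∫ y in (0 : ℝ)..1, g (y / (s t + r t * y))

lemma integral_comp_one_sub (f : ℝ → ℝ) : ∫ y in (0 : ℝ)..1, f (1 - y) = ∫ x in (0 : ℝ)..1, f x := by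
  rw [intervalIntegral.integral_comp_sub_left (fun x => f x) 1]
  simp

lemma IsSolution.transportedMass_eq_one (hw : IsSolution φ ψ w κ) (hM : IsModel a b q φ ψ)
    (hf : IsRiccatiFlow a b q κ s r) (hg0 : ∀ y ∈ Ioc (0 : ℝ) 1, w (1 - y) 0 = g y)
    {t : ℝ} (ht : 0 ≤ t) (hin : ∀ τ ∈ Icc 0 t, s τ + r τ ≤ s t + r t) :
    transportedMass g s r t = 1 := by
  rw [← hw.mass t ht, ← integral_comp_one_sub, transportedMass,
    ← intervalIntegral.integral_const_mul]
  refine intervalIntegral.integral_congr_ae (Filter.Eventually.of_forall fun y hy => ?_)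
  rw [uIoc_of_le zero_le_one] at hy
  exact (hw.eq_exp_mul_profile hM hf hg0 ht hin hy).symm

lemma hasDerivAt_transportedMass (hg : BoundaryProfile g) (hf : IsRiccatiFlow a b q κ s r) {t : ℝ}
    (ht : 0 ≤ t) (hsr : 1 ≤ s t + r t) :
    HasDerivAt (transportedMass g s r) (transportedMass g s r t - Real.exp t *
      ((b * κ t - a) * moebiusMoment g (s t) (r t) 1 +
        (a + q * κ t) * moebiusMoment g (s t) (r t) 2)) t := by
  have h := hasDerivAt_integral_comp_moebius hg.continuous hg.ac (hf.hasDerivAt_s t ht)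
    (hf.hasDerivAt_r t ht) (hf.s_pos t) hsr
  refine ((Real.hasDerivAt_exp t).mul h).congr_deriv ?_
  have := (hf.s_pos t).ne'
  rw [transportedMass, mul_div_cancel_right₀ _ this, mul_div_cancel_right₀ _ this]
  ring

lemma BoundaryProfile.intervalIntegrable_deriv_mul (hg : BoundaryProfile g) {m : ℝ} (hm : 0 ≤ m)
    (hm1 : m ≤ 1) {f : ℝ → ℝ} (hf : ContinuousOn f (Icc 0 m)) :
    IntervalIntegrable (fun z => deriv g z * f z) volume 0 m :=
  (hg.ac_mono le_rfl hm hm1).intervalIntegrable_deriv.mul_continuousOn (by rwa [uIcc_of_le hm])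

lemma moebius_inv_mem_Icc {s r z : ℝ} (hs : 0 < s) (hsr : 0 < s + r)
    (hz : z ∈ Icc 0 (1 / (s + r))) : s * z / (1 - r * z) ∈ Icc (0 : ℝ) 1 := by
  have h0 := moebius_inv_denom_pos hs hsr hz
  have h1 : (s + r) * z ≤ 1 := by
    have := mul_le_mul_of_nonneg_left hz.2 hsr.le
    rwa [mul_one_div_cancel hsr.ne'] at this
  refine ⟨div_nonneg (mul_nonneg hs.le hz.1) h0.le, ?_⟩
  rw [div_le_one h0]
  linarith

lemma continuousOn_moebius_inv {s r : ℝ} (hs : 0 < s) (hsr : 0 < s + r) :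
    ContinuousOn (fun z => s * z / (1 - r * z)) (Icc 0 (1 / (s + r))) :=
  ContinuousOn.div (by fun_prop) (by fun_prop) fun _ hz => (moebius_inv_denom_pos hs hsr hz).ne'

lemma BoundaryProfile.intervalIntegrable_moment (hg : BoundaryProfile g) {s r : ℝ} (hs : 0 < s)
    (hsr : 1 ≤ s + r) (n : ℕ) :
    IntervalIntegrable (fun z => deriv g z * (s * z / (1 - r * z)) ^ n) volume 0 (1 / (s + r)) :=
  hg.intervalIntegrable_deriv_mul (by positivity) (by rw [div_le_one (by linarith)]; exact hsr)
    ((continuousOn_moebius_inv hs (by linarith)).pow n)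

lemma BoundaryProfile.moment_nonneg (hg : BoundaryProfile g) {s r : ℝ} (hs : 0 < s)
    (hsr : 1 ≤ s + r) (n : ℕ) : 0 ≤ moebiusMoment g s r n :=
  intervalIntegral.integral_nonneg (by positivity) fun _ hz =>
    mul_nonneg hg.monotone.deriv_nonneg
      (pow_nonneg (moebius_inv_mem_Icc hs (by linarith) hz).1 n)

lemma BoundaryProfile.moment_two_le_one (hg : BoundaryProfile g) {s r : ℝ} (hs : 0 < s)
    (hsr : 1 ≤ s + r) : moebiusMoment g s r 2 ≤ moebiusMoment g s r 1 := by
  refine intervalIntegral.integral_mono_on (by positivity) (hg.intervalIntegrable_moment hs hsr 2)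
    (hg.intervalIntegrable_moment hs hsr 1) fun z hz => ?_
  have h := moebius_inv_mem_Icc hs (by linarith) hz
  exact mul_le_mul_of_nonneg_left (pow_le_pow_of_le_one h.1 h.2 one_le_two)
    hg.monotone.deriv_nonneg

/-- The balance of mass forces the parameter to be positive. -/
lemma kappa_pos_of_balance {a b q k e S₁ S₂ : ℝ} (ha : 0 < a) (hb : 0 < b) (hq : 0 ≤ q)
    (he : 0 < e) (h2 : 0 ≤ S₂) (h21 : S₂ ≤ S₁)
    (h : e * ((b * k - a) * S₁ + (a + q * k) * S₂) = 1) : 0 < k := by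
  by_contra hk
  push Not at hk
  have h1 : (b * k - a) * S₁ + (a + q * k) * S₂ ≤ 0 := by
    have e1 : 0 ≤ a * (S₁ - S₂) := by apply mul_nonneg <;> linarith
    have e2 : 0 ≤ b * S₁ + q * S₂ := by
      have : 0 ≤ S₁ := h2.trans h21
      positivity
    nlinarith [mul_nonneg (neg_nonneg.2 hk) e2]
  nlinarith

open Filter Topology in
/-- At time `0` the balance of mass holds whatever the sign of `κ` is: the characteristics that
enter at `x = 0` before a small time `t` fill a strip of width `O(t)`, and in it the continuity of
`w` replaces the missing boundary values. -/
lemma IsSolution.balance_zero (hw : IsSolution φ ψ w κ) (hM : IsModel a b q φ ψ)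
    (hf : IsRiccatiFlow a b q κ s r) (hg : BoundaryProfile g)
    (hg0 : ∀ y ∈ Ioc (0 : ℝ) 1, w (1 - y) 0 = g y) :
    (b * κ 0 - a) * moebiusMoment g (s 0) (r 0) 1 +
      (a + q * κ 0) * moebiusMoment g (s 0) (r 0) 2 = 1 := by
  have hsr0 : s 0 + r 0 = 1 := by rw [hf.s_zero, hf.r_zero, add_zero]
  have hD := hasDerivAt_transportedMass hg hf le_rfl hsr0.ge
  have hm0 : transportedMass g s r 0 = 1 :=
    hw.transportedMass_eq_one hM hf hg0 le_rfl fun τ hτ => by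
      rw [le_antisymm hτ.2 hτ.1]
  rw [hm0, Real.exp_zero, one_mul] at hD
  suffices h : HasDerivWithinAt (transportedMass g s r) 0 (Ici 0) 0 by
    have := (uniqueDiffWithinAt_Ici (0 : ℝ)).eq_deriv _ hD.hasDerivWithinAt h
    linarith
  -- `s + r` is Lipschitz near `0`
  obtain ⟨C, hC0, t₀, ht₀, hlip⟩ : ∃ C : ℝ, 0 < C ∧ ∃ t₀ : ℝ, 0 < t₀ ∧
      ∀ t ∈ Ico 0 t₀, ∀ τ ∈ Icc 0 t, s τ + r τ - (s t + r t) ≤ C * t := by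
    obtain ⟨B, hB⟩ := (isCompact_Icc (a := (0 : ℝ)) (b := 1)).exists_bound_of_continuousOn
      (f := fun t => (b * κ t - a) * s t + (a + q * κ t) * s t) (by
        have h1 : ContinuousOn κ (Icc 0 1) := hw.continuousOn_kappa.mono fun t ht => ht.1
        have h2 : ContinuousOn s (Icc 0 1) := fun t ht =>
          (hf.hasDerivAt_s t ht.1).continuousAt.continuousWithinAt
        fun_prop)
    refine ⟨|B| + 1, by positivity, 1, one_pos, fun t ht τ hτ => ?_⟩
    have h := (convex_Icc (0 : ℝ) 1).norm_image_sub_le_of_norm_hasDerivWithin_le (C := B)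
      (f := fun t => s t + r t) (fun x hx =>
      ((hf.hasDerivAt_s x hx.1).add (hf.hasDerivAt_r x hx.1)).hasDerivWithinAt) hB
      (x := t) (y := τ) ⟨ht.1, ht.2.le⟩ ⟨hτ.1, hτ.2.trans ht.2.le⟩
    have h1 := (le_abs_self _).trans h
    refine h1.trans ?_
    have h2 : ‖τ - t‖ ≤ t := by
      rw [Real.norm_eq_abs, abs_le]
      constructor <;> linarith [hτ.1, hτ.2]
    have := ht.1
    calc B * ‖τ - t‖ ≤ (|B| + 1) * ‖τ - t‖ := by
          gcongr
          linarith [le_abs_self B]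
      _ ≤ (|B| + 1) * t := by gcongr
  set C' := 2 * C with hC'
  -- the discrepancy between the solution and the transported profile
  set D : ℝ × ℝ → ℝ := fun p => Real.exp p.2 * g (p.1 / (s p.2 + r p.2 * p.1)) - w (1 - p.1) p.2
    with hDdef
  have hsc := (hf.hasDerivAt_s 0 le_rfl).continuousAt
  have hrc := (hf.hasDerivAt_r 0 le_rfl).continuousAt
  have hDc : Tendsto D (𝓝[Ioc 0 1 ×ˢ Ici 0] (1, 0)) (𝓝 0) := by
    have h1 : ContinuousWithinAt (fun p : ℝ × ℝ => w (1 - p.1) p.2) (Ioc 0 1 ×ˢ Ici 0) (1, 0) := by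
      have hcw := hw.continuousOn_w (0, 0) (by simp)
      refine ContinuousWithinAt.comp (f := fun p : ℝ × ℝ => (1 - p.1, p.2)) (x := (1, 0))
        (t := Ico 0 1 ×ˢ Ici 0) (g := fun p : ℝ × ℝ => w p.1 p.2) (by simpa using hcw)
        (by fun_prop) ?_
      rintro ⟨y, t⟩ ⟨hy, ht⟩
      exact ⟨⟨by linarith [hy.2], by linarith [hy.1]⟩, ht⟩
    have hs2 : ContinuousAt (fun p : ℝ × ℝ => s p.2) (1, 0) :=
      ContinuousAt.comp (f := fun p : ℝ × ℝ => p.2) (x := (1, 0)) hsc continuousAt_snd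
    have hr2 : ContinuousAt (fun p : ℝ × ℝ => r p.2) (1, 0) :=
      ContinuousAt.comp (f := fun p : ℝ × ℝ => p.2) (x := (1, 0)) hrc continuousAt_snd
    have h2 : ContinuousAt (fun p : ℝ × ℝ =>
        Real.exp p.2 * g (p.1 / (s p.2 + r p.2 * p.1))) (1, 0) := by
      refine ContinuousAt.mul (by fun_prop) ?_
      refine ContinuousAt.comp (f := fun p : ℝ × ℝ => p.1 / (s p.2 + r p.2 * p.1))
        hg.continuous.continuousAt ?_
      exact continuousAt_fst.div (hs2.add (hr2.mul continuousAt_fst))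
        (by simp [hf.s_zero, hf.r_zero])
    have h3 := h2.continuousWithinAt.sub h1
    have h4 : D (1, 0) = 0 := by
      have := hg0 1 ⟨one_pos, le_rfl⟩
      simp [hDdef, hf.s_zero, hf.r_zero, ← this]
    have h5 : Tendsto D (𝓝[Ioc 0 1 ×ˢ Ici 0] (1, 0)) (𝓝 (D (1, 0))) := h3
    rwa [h4] at h5
  rw [hasDerivWithinAt_iff_isLittleO, Asymptotics.isLittleO_iff]
  intro ε hε
  obtain ⟨η, hη, hball⟩ := Metric.mem_nhdsWithin_iff.1
    (hDc (Metric.ball_mem_nhds 0 (show 0 < ε / C' by positivity)))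
  have hev1 : ∀ᶠ t in 𝓝[Ici 0] (0 : ℝ), t < t₀ ∧ C' * t < η ∧ C' * t < 1 ∧ t < η := by
    refine Filter.Eventually.filter_mono nhdsWithin_le_nhds ?_
    have hc : ContinuousAt (fun t : ℝ => C' * t) 0 := by fun_prop
    refine (eventually_lt_nhds ht₀).and (((hc.tendsto.eventually_lt_const (u := η) (by simpa))).and
      ((hc.tendsto.eventually_lt_const (u := 1) (by simp)).and (eventually_lt_nhds hη)))
  have hev2 : ∀ᶠ t in 𝓝[Ici 0] (0 : ℝ), 1 / 2 < s t ∧ 0 < s t + r t := by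
    refine Filter.Eventually.filter_mono nhdsWithin_le_nhds ?_
    exact (hsc.eventually_const_lt (by rw [hf.s_zero]; norm_num)).and
      ((hsc.add hrc).eventually_const_lt (by simp [hsr0]))
  filter_upwards [hev1, hev2, self_mem_nhdsWithin] with t ⟨h1, h2, h3, h4⟩ ⟨h5, h6⟩ ht
  have ht' : 0 ≤ t := ht
  -- the characteristics that end in `y ≤ 1 - C' t` were never outside
  have hzero : ∀ y ∈ Ioc 0 (1 - C' * t), D (y, t) = 0 := by
    intro y hy
    have hy1 : y ≤ 1 := hy.2.trans (by nlinarith)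
    have h := hw.eq_exp_mul hM hf ht' hy.1 fun τ hτ => by
      have h7 := hlip t ⟨ht', h1⟩ τ hτ
      have h8 : s t + C * t ≤ s t / y := by
        rw [le_div_iff₀ hy.1]
        have h9 : C' * t ≤ 1 - y := by linarith [hy.2]
        have h10 : C * t * y ≤ C * t * 1 := by gcongr
        nlinarith
      linarith
    simp only [hDdef]
    rw [h.2, hg0 _ h.1, sub_self]
  have hsmall : ∀ y ∈ Ioc (1 - C' * t) 1, ‖D (y, t)‖ ≤ ε / C' := by
    intro y hy
    have hmem : (y, t) ∈ Metric.ball ((1 : ℝ), (0 : ℝ)) η ∩ Ioc 0 1 ×ˢ Ici 0 := by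
      refine ⟨?_, ⟨by linarith [hy.1], hy.2⟩, ht⟩
      rw [Metric.mem_ball, Prod.dist_eq, max_lt_iff, Real.dist_eq, Real.dist_eq, abs_lt, abs_lt]
      refine ⟨⟨?_, ?_⟩, ?_, ?_⟩ <;> simp only <;> linarith [hy.1, hy.2]
    have := hball hmem
    rw [mem_preimage, Metric.mem_ball, dist_zero_right] at this
    exact this.le
  have hwi : IntervalIntegrable (fun y => w (1 - y) t) volume 0 1 := by
    by_contra hni
    have := intervalIntegral.integral_undef hni
    rw [integral_comp_one_sub (fun x => w x t), hw.mass t ht'] at this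
    exact one_ne_zero this
  have hgi : IntervalIntegrable (fun y => Real.exp t * g (y / (s t + r t * y))) volume 0 1 := by
    refine ContinuousOn.intervalIntegrable ?_
    rw [uIcc_of_le zero_le_one]
    refine continuousOn_const.mul (hg.continuous.comp_continuousOn
      (ContinuousOn.div (by fun_prop) (by fun_prop) fun y hy => ?_))
    exact (moebius_denom_pos (hf.s_pos t) h6 hy).ne'
  have hDi : IntervalIntegrable (fun y => D (y, t)) volume 0 1 := hgi.sub hwi
  have hCt : 0 ≤ C' * t := by positivity
  have hint : transportedMass g s r t - transportedMass g s r 0 = ∫ y in (0 : ℝ)..1, D (y, t) := by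
    simp only [hDdef]
    rw [intervalIntegral.integral_sub hgi hwi, integral_comp_one_sub (fun x => w x t),
      hw.mass t ht', hm0, intervalIntegral.integral_const_mul, transportedMass]
  have hsplit := intervalIntegral.integral_add_adjacent_intervals (μ := volume)
    (f := fun y => D (y, t)) (a := 0) (b := 1 - C' * t) (c := 1)
    (hDi.mono_set (by
      rw [uIcc_of_le (by linarith), uIcc_of_le zero_le_one]
      exact Icc_subset_Icc_right (by linarith)))
    (hDi.mono_set (by
      rw [uIcc_of_le (by linarith), uIcc_of_le zero_le_one]
      exact Icc_subset_Icc_left (by linarith)))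
  have hfirst : ∫ y in (0 : ℝ)..1 - C' * t, D (y, t) = 0 := by
    refine intervalIntegral.integral_zero_ae (Filter.Eventually.of_forall fun y hy => ?_)
    rw [uIoc_of_le (by linarith)] at hy
    exact hzero y hy
  have hsecond := intervalIntegral.norm_integral_le_of_norm_le_const (a := 1 - C' * t) (b := 1)
    (f := fun y => D (y, t)) (C := ε / C') (fun y hy => by
      rw [uIoc_of_le (by linarith)] at hy
      exact hsmall y hy)
  rw [smul_zero, sub_zero, hint, ← hsplit, hfirst, zero_add]
  refine hsecond.trans (le_of_eq ?_)
  have hC'0 : C' ≠ 0 := by positivity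
  rw [sub_sub_cancel, sub_zero, abs_of_nonneg hCt, Real.norm_eq_abs, abs_of_nonneg ht']
  field_simp

lemma IsRiccatiFlow.add_monotone (hf : IsRiccatiFlow a b q κ s r) (hb : 0 < b) (hq : 0 ≤ q) {T : ℝ}
    (hκ : ∀ t ∈ Icc 0 T, 0 ≤ κ t) : MonotoneOn (fun t => s t + r t) (Icc 0 T) := by
  have hd : ∀ t ∈ Icc 0 T, HasDerivAt (fun t => s t + r t)
      ((b * κ t - a) * s t + (a + q * κ t) * s t) t := fun t ht =>
    (hf.hasDerivAt_s t ht.1).add (hf.hasDerivAt_r t ht.1)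
  refine monotoneOn_of_hasDerivWithinAt_nonneg (convex_Icc 0 T)
    (fun t ht => (hd t ht).continuousAt.continuousWithinAt)
    (fun t ht => (hd t (interior_subset ht)).hasDerivWithinAt) fun t ht => ?_
  have h1 := hκ t (interior_subset ht)
  have h2 := hf.s_pos t
  have : (b * κ t - a) * s t + (a + q * κ t) * s t = (b + q) * κ t * s t := by ring
  rw [this]
  positivity

/-- The balance of mass at a positive time up to which `κ` has been nonnegative. -/
lemma IsSolution.balance_of_nonneg (hw : IsSolution φ ψ w κ) (hM : IsModel a b q φ ψ)
    (hf : IsRiccatiFlow a b q κ s r) (hg : BoundaryProfile g)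
    (hg0 : ∀ y ∈ Ioc (0 : ℝ) 1, w (1 - y) 0 = g y) {T : ℝ} (hT : 0 < T)
    (hκ : ∀ t ∈ Icc 0 T, 0 ≤ κ t) :
    1 ≤ s T + r T ∧ Real.exp T * ((b * κ T - a) * moebiusMoment g (s T) (r T) 1 +
      (a + q * κ T) * moebiusMoment g (s T) (r T) 2) = 1 := by
  have hmono := hf.add_monotone hM.b_pos hM.q_nonneg hκ
  have hsr : 1 ≤ s T + r T := by
    have := hmono ⟨le_rfl, hT.le⟩ ⟨hT.le, le_rfl⟩ hT.le
    simpa [hf.s_zero, hf.r_zero] using this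
  have hone : ∀ t ∈ Icc 0 T, transportedMass g s r t = 1 := fun t ht =>
    hw.transportedMass_eq_one hM hf hg0 ht.1 fun τ hτ =>
      hmono ⟨hτ.1, hτ.2.trans ht.2⟩ ht hτ.2
  have hTm : T ∈ Icc 0 T := ⟨hT.le, le_rfl⟩
  have h1 := (hasDerivAt_transportedMass hg hf hT.le hsr).hasDerivWithinAt (s := Icc 0 T)
  have h2 : HasDerivWithinAt (transportedMass g s r) 0 (Icc 0 T) T :=
    (hasDerivWithinAt_const T (Icc 0 T) (1 : ℝ)).congr hone (hone T hTm)
  have h3 := ((uniqueDiffOn_Icc hT) T hTm).eq_deriv _ h1 h2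
  rw [hone T hTm] at h3
  exact ⟨hsr, by linarith⟩

/-- The parameter of a solution is positive at all times, although no sign is imposed on it: its
first zero would contradict the balance of mass. -/
lemma IsSolution.kappa_pos (hw : IsSolution φ ψ w κ) (hM : IsModel a b q φ ψ) {t : ℝ}
    (ht : 0 ≤ t) : 0 < κ t := by
  obtain ⟨s, r, hf⟩ := exists_isRiccatiFlow a b q hw.continuousOn_kappa
  obtain ⟨g, hg, hg0⟩ := hw.initial.exists_boundaryProfile
  have hκ0 : 0 < κ 0 := by
    have hsr0 : 1 ≤ s 0 + r 0 := by rw [hf.s_zero, hf.r_zero, add_zero]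
    have h := hw.balance_zero hM hf hg hg0
    exact kappa_pos_of_balance hM.a_pos hM.b_pos hM.q_nonneg one_pos
      (hg.moment_nonneg (hf.s_pos 0) hsr0 2) (hg.moment_two_le_one (hf.s_pos 0) hsr0)
      (by rw [one_mul]; exact h)
  by_contra hneg
  push Not at hneg
  have hKc : IsCompact (Icc 0 t ∩ κ ⁻¹' Iic 0) :=
    isCompact_Icc.of_isClosed_subset
      ((hw.continuousOn_kappa.mono fun x hx => hx.1).preimage_isClosed_of_isClosed isClosed_Icc
        isClosed_Iic) inter_subset_left
  obtain ⟨T, ⟨hTt, hTκ⟩, hleast⟩ := hKc.exists_isLeast ⟨t, ⟨ht, le_rfl⟩, hneg⟩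
  have hT0 : 0 < T := by
    rcases eq_or_lt_of_le hTt.1 with h | h
    · rw [← h] at hTκ
      exact absurd hTκ (not_le.2 hκ0)
    · exact h
  have hpos : ∀ τ ∈ Ico 0 T, 0 < κ τ := fun τ hτ => by
    by_contra hc
    push Not at hc
    exact absurd (hleast ⟨⟨hτ.1, hτ.2.le.trans hTt.2⟩, hc⟩) (not_le.2 hτ.2)
  have hκT : 0 ≤ κ T := by
    have hcl : T ∈ closure (Ico 0 T) := by rw [closure_Ico hT0.ne]; exact ⟨hT0.le, le_rfl⟩
    have hc : ContinuousWithinAt κ (Ico 0 T) T :=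
      (hw.continuousOn_kappa T hTt.1).mono fun x hx => hx.1
    have hne : (nhdsWithin T (Ico 0 T)).NeBot := mem_closure_iff_nhdsWithin_neBot.1 hcl
    exact ge_of_tendsto (b := 0) hc.tendsto (by
      filter_upwards [self_mem_nhdsWithin] with x hx using (hpos x hx).le)
  obtain ⟨hsr, hbal⟩ := hw.balance_of_nonneg hM hf hg hg0 hT0 fun τ hτ => by
    rcases eq_or_lt_of_le hτ.2 with h | h
    · rw [h]; exact hκT
    · exact (hpos τ ⟨hτ.1, h⟩).le
  exact absurd hTκ (not_le.2 (kappa_pos_of_balance hM.a_pos hM.b_pos hM.q_nonneg (Real.exp_pos T)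
      (hg.moment_nonneg (hf.s_pos T) hsr 2) (hg.moment_two_le_one (hf.s_pos T) hsr) hbal))

/-- The function `w` is at all times the initial profile `g`, transported by the Möbius flow `(s, r)`
and multiplied by `eᵗ`, it has unit mass and satisfies the balance of mass, and the flow only leaves
the domain. -/
structure IsTransported (a b q : ℝ) (w : ℝ → ℝ → ℝ) (κ s r g : ℝ → ℝ) : Prop where
  kappa_pos : ∀ t, 0 ≤ t → 0 < κ t
  one_le : ∀ t, 0 ≤ t → 1 ≤ s t + r t
  r_nonneg : ∀ t, 0 ≤ t → 0 ≤ r t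
  eq_profile : ∀ t, 0 ≤ t → ∀ y ∈ Ioc (0 : ℝ) 1,
    w (1 - y) t = Real.exp t * g (y / (s t + r t * y))
  mass : ∀ t, 0 ≤ t → transportedMass g s r t = 1
  balance : ∀ t, 0 ≤ t → Real.exp t * ((b * κ t - a) * moebiusMoment g (s t) (r t) 1 +
      (a + q * κ t) * moebiusMoment g (s t) (r t) 2) = 1

lemma IsSolution.isTransported (hw : IsSolution φ ψ w κ) (hM : IsModel a b q φ ψ)
    (hf : IsRiccatiFlow a b q κ s r) (hg : BoundaryProfile g)
    (hg0 : ∀ y ∈ Ioc (0 : ℝ) 1, w (1 - y) 0 = g y) : IsTransported a b q w κ s r g := by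
  have hκ : ∀ t, 0 ≤ t → 0 < κ t := fun t ht => hw.kappa_pos hM ht
  have hmono : ∀ t, 0 ≤ t → ∀ τ ∈ Icc 0 t, s τ + r τ ≤ s t + r t := fun t ht τ hτ =>
    hf.add_monotone hM.b_pos hM.q_nonneg (fun u hu => (hκ u hu.1).le) hτ ⟨ht, le_rfl⟩ hτ.2
  refine ⟨hκ, fun t ht => ?_, fun t ht => ?_,
    fun t ht y hy => hw.eq_exp_mul_profile hM hf hg0 ht (hmono t ht) hy,
    fun t ht => hw.transportedMass_eq_one hM hf hg0 ht (hmono t ht), fun t ht => ?_⟩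
  · have := hmono t ht 0 ⟨le_rfl, ht⟩
    rwa [hf.s_zero, hf.r_zero, add_zero] at this
  · have h : MonotoneOn r (Icc 0 t) := by
      refine monotoneOn_of_hasDerivWithinAt_nonneg (convex_Icc 0 t)
        (fun u hu => (hf.hasDerivAt_r u hu.1).continuousAt.continuousWithinAt)
        (fun u hu => (hf.hasDerivAt_r u (interior_subset hu).1).hasDerivWithinAt) fun u hu => ?_
      have h1 := hκ u (interior_subset hu).1
      have h2 := hf.s_pos u
      have h3 := hM.a_pos
      have h4 := hM.q_nonneg
      positivity
    have := h ⟨le_rfl, ht⟩ ⟨ht, le_rfl⟩ ht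
    rwa [hf.r_zero] at this
  · rcases eq_or_lt_of_le ht with h | h
    · rw [← h, Real.exp_zero, one_mul]
      exact hw.balance_zero hM hf hg hg0
    · exact (hw.balance_of_nonneg hM hf hg hg0 h fun u hu => (hκ u hu.1).le).2

end Transport

/-! ### Exponential convergence of the parameter and of the flow -/

section Relaxation

/-- Exponential decay for `v' = (e - v) / D` with bounded `D` and exponentially small `e`: the
upper bound. No lower bound on `D` is needed, since a large relaxation rate only helps. -/
lemma relaxation_upper_bound {v e D : ℝ → ℝ} {d E γ : ℝ} (hd : 0 < d) (hE : 0 ≤ E)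
    (hv : ∀ t, 0 ≤ t → HasDerivAt v ((e t - v t) / D t) t)
    (hD0 : ∀ t, 0 ≤ t → 0 < D t) (hD : ∀ t, 0 ≤ t → D t ≤ d)
    (he : ∀ t, 0 ≤ t → e t ≤ E * Real.exp (-γ * t)) {t : ℝ} (ht : 0 ≤ t) :
    v t ≤ (2 * E + |v 0| + 1) * Real.exp (-min γ (1 / (2 * d)) * t) := by
  set C := 2 * E + |v 0| + 1 with hC
  have hC0 : 0 < C := by positivity
  set δ := min γ (1 / (2 * d)) with hδ
  have hδ1 : δ ≤ γ := min_le_left _ _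
  have hδ2 : δ ≤ 1 / (2 * d) := min_le_right _ _
  have hB : ∀ x, HasDerivAt (fun t => C * Real.exp (-δ * t)) (C * (Real.exp (-δ * x) * -δ)) x :=
    fun x => by simpa using (((hasDerivAt_id x).const_mul (-δ)).exp).const_mul C
  refine image_le_of_deriv_right_lt_deriv_boundary (f := v) (a := 0) (b := t)
    (fun x hx => (hv x hx.1).continuousAt.continuousWithinAt)
    (fun x hx => (hv x hx.1).hasDerivWithinAt) ?_ hB ?_ ⟨ht, le_rfl⟩
  · simp only [mul_zero, Real.exp_zero, mul_one, hC]
    linarith [le_abs_self (v 0)]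
  · intro x hx hvx
    have hDx := hD0 x hx.1
    set X := Real.exp (-δ * x) with hX
    have hX0 : 0 < X := Real.exp_pos _
    have h1 : e x ≤ E * X := (he x hx.1).trans (by
      gcongr 1
      rw [hX, Real.exp_le_exp]
      nlinarith [hx.1])
    rw [hvx, div_lt_iff₀ hDx]
    have h2 : δ * D x ≤ 1 / 2 := by
      calc δ * D x ≤ 1 / (2 * d) * D x := by gcongr
        _ ≤ 1 / (2 * d) * d := by gcongr; exact hD x hx.1
        _ = 1 / 2 := by field_simp
    have h3 : C * X * (δ * D x) ≤ C * X * (1 / 2) := by gcongr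
    have h4 : E * X < C * X * (1 / 2) := by
      have : 0 ≤ |v 0| := abs_nonneg _
      have : E < C * (1 / 2) := by rw [hC]; linarith
      nlinarith
    nlinarith

lemma relaxation_bound {v e D : ℝ → ℝ} {d E γ : ℝ} (hd : 0 < d) (hE : 0 ≤ E)
    (hv : ∀ t, 0 ≤ t → HasDerivAt v ((e t - v t) / D t) t)
    (hD0 : ∀ t, 0 ≤ t → 0 < D t) (hD : ∀ t, 0 ≤ t → D t ≤ d)
    (he : ∀ t, 0 ≤ t → |e t| ≤ E * Real.exp (-γ * t)) {t : ℝ} (ht : 0 ≤ t) :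
    |v t| ≤ (2 * E + |v 0| + 1) * Real.exp (-min γ (1 / (2 * d)) * t) := by
  have h1 := relaxation_upper_bound hd hE hv hD0 hD (fun t ht => (le_abs_self _).trans (he t ht)) ht
  have h2 := relaxation_upper_bound (v := fun t => -v t) (e := fun t => -e t) hd hE
    (fun t ht => by
      refine (hv t ht).neg.congr_deriv ?_
      ring) hD0 hD
    (fun t ht => (neg_le_abs _).trans (he t ht)) ht
  rw [abs_neg] at h2
  exact abs_le.2 ⟨by linarith, h1⟩

lemma exp_neg_mul_le {γ δ t : ℝ} (h : δ ≤ γ) (ht : 0 ≤ t) :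
    Real.exp (-γ * t) ≤ Real.exp (-δ * t) := by
  rw [Real.exp_le_exp]
  nlinarith

/-- A bound that holds eventually holds at all times for continuous functions, with a larger
constant. -/
lemma exists_exp_bound_of_eventually {f : ℝ → ℝ} (hf : ContinuousOn f (Ici 0)) {C γ T : ℝ}
    (hγ : 0 < γ) (h : ∀ t, 0 ≤ t → T ≤ t → |f t| ≤ C * Real.exp (-γ * t)) :
    ∃ C', 0 < C' ∧ ∀ t, 0 ≤ t → |f t| ≤ C' * Real.exp (-γ * t) := by
  obtain ⟨B, hB⟩ := (isCompact_Icc (a := (0 : ℝ)) (b := T)).exists_bound_of_continuousOn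
    (hf.mono fun x hx => hx.1)
  refine ⟨|C| + |B| * Real.exp (γ * T) + 1, by positivity, fun t ht => ?_⟩
  have hX := Real.exp_pos (-γ * t)
  have h0 : 0 ≤ |B| * Real.exp (γ * T) := by positivity
  rcases le_total T t with hTt | hTt
  · refine (h t ht hTt).trans ?_
    gcongr
    linarith [le_abs_self C]
  · have h1 : |f t| ≤ |B| := (hB t ⟨ht, hTt⟩).trans (le_abs_self B)
    have h2 : 1 ≤ Real.exp (γ * T) * Real.exp (-γ * t) := by
      rw [← Real.exp_add, Real.one_le_exp_iff]
      nlinarith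
    calc |f t| ≤ |B| * 1 := by rw [mul_one]; exact h1
      _ ≤ |B| * (Real.exp (γ * T) * Real.exp (-γ * t)) := by gcongr
      _ = (|B| * Real.exp (γ * T)) * Real.exp (-γ * t) := by ring
      _ ≤ _ := by
        gcongr
        linarith [abs_nonneg C]

end Relaxation

section Convergence

variable {a b q p L α : ℝ} {φ ψ : ℝ → ℝ} {w : ℝ → ℝ → ℝ} {κ s r g : ℝ → ℝ}

lemma BoundaryProfile.exists_rpow_le (hg : BoundaryProfile g) (hα : 0 < α) (hL : 0 < L)
    (hlog : ∀ᵐ z, z ∈ Ioo (0 : ℝ) 1 → |z * deriv g z - p * g z| ≤ L * z ^ α * g z) :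
    ∃ c, 0 < c ∧ ∀ z ∈ Icc (0 : ℝ) 1, 0 < z → c * z ^ p ≤ g z := by
  have hg1 := hg.pos 1 one_pos
  refine ⟨g 1 * Real.exp (-(L / α)), by positivity, fun z hz hz0 => ?_⟩
  have h := hg.abs_log_div_sub_le hα hL hlog hz0 hz.2 le_rfl
  rw [Real.one_rpow, mul_one] at h
  have h1 := (abs_le.1 h).2
  have hgz := hg.pos z hz0
  rw [Real.log_div hg1.ne' hgz.ne', one_div, Real.log_inv] at h1
  rw [← Real.exp_log hg1, ← Real.exp_log hgz, Real.rpow_def_of_pos hz0, ← Real.exp_add,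
    ← Real.exp_add, Real.exp_le_exp]
  linarith

/-- The part `[0, 1 / (s + r)]` of the initial profile that is still inside the domain shrinks
exponentially fast: its mass, multiplied by `eᵗ`, stays equal to one. -/
lemma IsTransported.exists_rpow_le (hT : IsTransported a b q w κ s r g)
    (hf : IsRiccatiFlow a b q κ s r) (hg : BoundaryProfile g) (hα : 0 < α) (hL : 0 < L)
    (hp : 0 < p)
    (hlog : ∀ᵐ z, z ∈ Ioo (0 : ℝ) 1 → |z * deriv g z - p * g z| ≤ L * z ^ α * g z) :
    ∃ C, 0 < C ∧ ∀ t, 0 ≤ t → (1 / (s t + r t)) ^ α ≤ C * Real.exp (-(α / p) * t) := by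
  obtain ⟨c, hc, hcg⟩ := hg.exists_rpow_le hα hL hlog
  refine ⟨((p + 1) / c) ^ (α / p), by positivity, fun t ht => ?_⟩
  have hsr := hT.one_le t ht
  have hsr0 : 0 < s t + r t := by linarith
  have hr := hT.r_nonneg t ht
  have hs := hf.s_pos t
  set m := 1 / (s t + r t) with hm
  have hm0 : 0 < m := by positivity
  have hm1 : m ≤ 1 := by rw [hm, div_le_one hsr0]; exact hsr
  have hint : c * m ^ p / (p + 1) ≤ ∫ y in (0 : ℝ)..1, g (y / (s t + r t * y)) := by
    have h1 : ∫ y in (0 : ℝ)..1, c * m ^ p * y ^ p = c * m ^ p / (p + 1) := by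
      rw [intervalIntegral.integral_const_mul, integral_rpow (Or.inl (by linarith)), Real.one_rpow,
        Real.zero_rpow (by linarith), sub_zero]
      ring
    rw [← h1]
    refine intervalIntegral.integral_mono_on_of_le_Ioo zero_le_one
      ((intervalIntegral.intervalIntegrable_rpow' (by linarith)).const_mul _) ?_ fun y hy => ?_
    · refine ContinuousOn.intervalIntegrable ?_
      rw [uIcc_of_le zero_le_one]
      refine hg.continuous.comp_continuousOn
        (ContinuousOn.div (by fun_prop) (by fun_prop) fun y hy => ?_)
      exact (moebius_denom_pos hs hsr0 hy).ne'
    · have hy0 := hy.1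
      have hmy : 0 < m * y := by positivity
      have hmy1 : m * y ≤ 1 := by nlinarith [hy.2]
      have h2 := hcg (m * y) ⟨hmy.le, hmy1⟩ hmy
      rw [Real.mul_rpow hm0.le hy0.le, ← mul_assoc] at h2
      refine h2.trans (hg.monotone ?_)
      rw [hm, one_div_mul_eq_div]
      have : 0 < s t + r t * y := by positivity
      gcongr
      nlinarith [hy.2]
  have hmass := hT.mass t ht
  rw [transportedMass] at hmass
  have hE := Real.exp_pos t
  have h3 : m ^ p ≤ (p + 1) / c * Real.exp (-t) := by
    have h4 : Real.exp t * (c * m ^ p / (p + 1)) ≤ 1 :=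
      (mul_le_mul_of_nonneg_left hint hE.le).trans hmass.le
    rw [Real.exp_neg]
    have h5 : m ^ p = (p + 1) / c * ((Real.exp t)⁻¹ * (Real.exp t * (c * m ^ p / (p + 1)))) := by
      field_simp
    rw [h5]
    gcongr
    calc _ ≤ (Real.exp t)⁻¹ * 1 := by gcongr
      _ = _ := mul_one _
  calc m ^ α = (m ^ p) ^ (α / p) := by
        rw [← Real.rpow_mul hm0.le, mul_div_cancel₀ _ hp.ne']
    _ ≤ ((p + 1) / c * Real.exp (-t)) ^ (α / p) := by gcongr
    _ = ((p + 1) / c) ^ (α / p) * Real.exp (-(α / p) * t) := by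
        rw [Real.mul_rpow (by positivity) (Real.exp_pos _).le, ← Real.exp_mul]
        congr 2
        ring

/-- The combination `S₁ + (r / s) S₂` of the moments is the integral of `z g'(z)`, which close to
the boundary is `p` times the integral of `g(z)`, that is `p` times the mass. -/
lemma IsTransported.abs_moment_sub_le (hT : IsTransported a b q w κ s r g)
    (hf : IsRiccatiFlow a b q κ s r) (hg : BoundaryProfile g) (hα : 0 < α) (hL : 0 < L)
    (hlog : ∀ᵐ z, z ∈ Ioo (0 : ℝ) 1 → |z * deriv g z - p * g z| ≤ L * z ^ α * g z)
    {t : ℝ} (ht : 0 ≤ t) :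
    |Real.exp t * (moebiusMoment g (s t) (r t) 1 + r t / s t * moebiusMoment g (s t) (r t) 2) - p|
      ≤ L * (1 / (s t + r t)) ^ α := by
  have hsr := hT.one_le t ht
  have hsr0 : 0 < s t + r t := by linarith
  have hs := hf.s_pos t
  set m := 1 / (s t + r t) with hm
  have hm0 : 0 < m := by positivity
  have hm1 : m ≤ 1 := by rw [hm, div_le_one hsr0]; exact hsr
  have hE := Real.exp_pos t
  set k : ℝ → ℝ := fun z => s t / (1 - r t * z) ^ 2 with hk
  have hden : ∀ z ∈ Icc 0 m, 0 < 1 - r t * z := fun z hz => moebius_inv_denom_pos hs hsr0 hz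
  have hkc : ContinuousOn k (Icc 0 m) :=
    ContinuousOn.div (by fun_prop) (by fun_prop) fun z hz => (pow_pos (hden z hz) 2).ne'
  have hk0 : ∀ z ∈ Icc 0 m, 0 < k z := fun z hz => div_pos hs (pow_pos (hden z hz) 2)
  have hmass : Real.exp t * ∫ z in (0 : ℝ)..m, k z * g z = 1 := by
    rw [← hT.mass t ht, transportedMass, integral_comp_moebius hs hsr0 hg.continuous]
    congr 1
    refine intervalIntegral.integral_congr fun z _ => ?_
    simp only [hk]
    ring
  have hmom : moebiusMoment g (s t) (r t) 1 + r t / s t * moebiusMoment g (s t) (r t) 2 =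
      ∫ z in (0 : ℝ)..m, deriv g z * (z * k z) := by
    rw [moebiusMoment, moebiusMoment, ← intervalIntegral.integral_const_mul,
      ← intervalIntegral.integral_add (hg.intervalIntegrable_moment hs hsr 1)
        ((hg.intervalIntegrable_moment hs hsr 2).const_mul _)]
    refine intervalIntegral.integral_congr fun z hz => ?_
    rw [uIcc_of_le hm0.le] at hz
    have := hden z hz
    simp only [hk]
    field_simp
    ring
  have hi1 : IntervalIntegrable (fun z => deriv g z * (z * k z)) volume 0 m :=
    hg.intervalIntegrable_deriv_mul hm0.le hm1 (continuousOn_id.mul hkc)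
  have hi2 : IntervalIntegrable (fun z => k z * g z) volume 0 m :=
    ContinuousOn.intervalIntegrable (by
      rw [uIcc_of_le hm0.le]; exact hkc.mul hg.continuous.continuousOn)
  have hdiff : Real.exp t * (∫ z in (0 : ℝ)..m, deriv g z * (z * k z)) - p =
      Real.exp t * ∫ z in (0 : ℝ)..m, (deriv g z * (z * k z) - p * (k z * g z)) := by
    rw [intervalIntegral.integral_sub hi1 (hi2.const_mul p), intervalIntegral.integral_const_mul]
    linear_combination p * hmass
  have hbound : |∫ z in (0 : ℝ)..m, (deriv g z * (z * k z) - p * (k z * g z))| ≤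
      ∫ z in (0 : ℝ)..m, L * m ^ α * (k z * g z) := by
    rw [← Real.norm_eq_abs]
    refine intervalIntegral.norm_integral_le_of_norm_le hm0.le ?_ (hi2.const_mul _)
    have hb : ∀ᵐ z : ℝ, z ≠ 1 := by simp [ae_iff, measure_singleton]
    filter_upwards [hlog, hb] with z hz hz1 hzm
    have hz01 : z ∈ Ioo (0 : ℝ) 1 := ⟨hzm.1, lt_of_le_of_ne (hzm.2.trans hm1) hz1⟩
    have hkz := hk0 z ⟨hzm.1.le, hzm.2⟩
    have hgz := hg.pos z hzm.1
    rw [Real.norm_eq_abs]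
    calc |deriv g z * (z * k z) - p * (k z * g z)| = k z * |z * deriv g z - p * g z| := by
          rw [← abs_of_pos hkz, ← abs_mul, abs_of_pos hkz]
          congr 1
          ring
      _ ≤ k z * (L * z ^ α * g z) := by gcongr; exact hz hz01
      _ ≤ k z * (L * m ^ α * g z) := by
          have := hzm.1.le
          gcongr
          exact hzm.2
      _ = _ := by ring
  rw [hmom, hdiff, abs_mul, abs_of_pos hE]
  refine (mul_le_mul_of_nonneg_left hbound hE.le).trans (le_of_eq ?_)
  rw [intervalIntegral.integral_const_mul]
  linear_combination L * m ^ α * hmass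

/-- Exponential convergence of `κ` and of the ratio `F = r / s`, which determines the shape of the
profile. The balance of mass turns the equation for `F` into
`F' = (A P + Q - F) / D` with `Q = q / b`, `A = a (1 + Q)`, `P = eᵗ (S₁ + F S₂) → p` and a bounded
positive `D`. -/
lemma IsTransported.exists_convergence (hT : IsTransported a b q w κ s r g)
    (hM : IsModel a b q φ ψ) (hκc : ContinuousOn κ (Ici 0))
    (hf : IsRiccatiFlow a b q κ s r) (hg : BoundaryProfile g) (hα : 0 < α) (hL : 0 < L)
    (hp : 0 < p)
    (hlog : ∀ᵐ z, z ∈ Ioo (0 : ℝ) 1 → |z * deriv g z - p * g z| ≤ L * z ^ α * g z) :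
    ∃ C γ, 0 < C ∧ 0 < γ ∧ ∀ t, 0 ≤ t →
      |κ t - (a + 1 / p) / b| ≤ C * Real.exp (-γ * t) ∧
      |r t / s t - (a * (1 + q / b) * p + q / b)| ≤ C * Real.exp (-γ * t) ∧
      (1 / (s t + r t)) ^ α ≤ C * Real.exp (-γ * t) := by
  obtain ⟨C₀, hC₀, hm⟩ := hT.exists_rpow_le hf hg hα hL hp hlog
  have ha := hM.a_pos
  have hb := hM.b_pos
  have hq := hM.q_nonneg
  set γ₀ := α / p with hγ₀
  have hγ₀0 : 0 < γ₀ := by positivity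
  set Q := q / b with hQ
  have hQ0 : 0 ≤ Q := by positivity
  have hqQ : q = Q * b := by rw [hQ]; field_simp
  set A := a * (1 + Q) with hA
  have hA0 : 0 < A := by positivity
  set F : ℝ → ℝ := fun t => r t / s t with hF
  set T₁ : ℝ → ℝ := fun t => Real.exp t * moebiusMoment g (s t) (r t) 1 with hT₁
  set T₂ : ℝ → ℝ := fun t => Real.exp t * moebiusMoment g (s t) (r t) 2 with hT₂
  set P : ℝ → ℝ := fun t => T₁ t + F t * T₂ t with hP
  set D : ℝ → ℝ := fun t => T₁ t + Q * T₂ t with hD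
  set ν : ℝ → ℝ := fun t => b * κ t - a with hν
  have hF0 : ∀ t, 0 ≤ t → 0 ≤ F t := fun t ht => div_nonneg (hT.r_nonneg t ht) (hf.s_pos t).le
  have hT₂0 : ∀ t, 0 ≤ t → 0 ≤ T₂ t := fun t ht =>
    mul_nonneg (Real.exp_pos t).le (hg.moment_nonneg (hf.s_pos t) (hT.one_le t ht) 2)
  have hT₂₁ : ∀ t, 0 ≤ t → T₂ t ≤ T₁ t := fun t ht =>
    mul_le_mul_of_nonneg_left (hg.moment_two_le_one (hf.s_pos t) (hT.one_le t ht))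
      (Real.exp_pos t).le
  have hbal : ∀ t, 0 ≤ t → ν t * T₁ t + (a + q * κ t) * T₂ t = 1 := fun t ht => by
    rw [← hT.balance t ht]; simp only [hν, hT₁, hT₂]; ring
  have hPp : ∀ t, 0 ≤ t → |P t - p| ≤ L * C₀ * Real.exp (-γ₀ * t) := fun t ht => by
    have h1 := hT.abs_moment_sub_le hf hg hα hL hlog ht
    have h2 : P t = Real.exp t * (moebiusMoment g (s t) (r t) 1 +
        r t / s t * moebiusMoment g (s t) (r t) 2) := by simp only [hP, hT₁, hT₂, hF]; ring
    rw [h2, mul_assoc]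
    exact h1.trans (by gcongr; exact hm t ht)
  have hT₁0 : ∀ t, 0 ≤ t → 0 < T₁ t := fun t ht => by
    have h1 := hT₂0 t ht
    have h2 := hT₂₁ t ht
    have h3 := hbal t ht
    rcases eq_or_lt_of_le (h1.trans h2) with h | h
    · have h4 : T₂ t = 0 := le_antisymm (h ▸ h2) h1
      rw [← h, h4] at h3
      simp at h3
    · exact h
  have hD0 : ∀ t, 0 ≤ t → 0 < D t := fun t ht => by
    have := hT₁0 t ht
    have := hT₂0 t ht
    positivity
  have hDP : ∀ t, 0 ≤ t → D t ≤ (1 + Q) * P t := fun t ht => by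
    have h1 := hT₂0 t ht
    have h2 := hT₂₁ t ht
    have h3 := mul_nonneg (hF0 t ht) h1
    have h4 := mul_le_mul_of_nonneg_left h2 hQ0
    have h5 := mul_nonneg hQ0 h3
    simp only [hD, hP]
    nlinarith
  have hPD : ∀ t, 0 ≤ t → P t ≤ (1 + F t) * D t := fun t ht => by
    have h1 := hT₂0 t ht
    have h2 := mul_le_mul_of_nonneg_left (hT₂₁ t ht) (hF0 t ht)
    have h3 := mul_nonneg hQ0 h1
    have h4 := mul_nonneg (hF0 t ht) h3
    simp only [hD, hP]
    nlinarith
  have hFd' : ∀ t, 0 ≤ t → HasDerivAt F (a + q * κ t - ν t * F t) t := fun t ht => by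
    refine ((hf.hasDerivAt_r t ht).div (hf.hasDerivAt_s t ht) (hf.s_pos t).ne').congr_deriv ?_
    have := hf.s_pos t
    simp only [hF, hν]
    field_simp
  have hFeq : ∀ t, 0 ≤ t → a + q * κ t - ν t * F t = (A * P t + Q - F t) / D t := fun t ht => by
    rw [eq_div_iff (hD0 t ht).ne']
    have h3 := hbal t ht
    rw [hqQ] at h3 ⊢
    simp only [hν, hD, hP, hA] at h3 ⊢
    linear_combination (Q - F t) * h3
  set Flim := A * p + Q with hFlim
  set E := A * (L * C₀) with hE
  have hE0 : 0 ≤ E := by positivity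
  set d := (1 + Q) * (p + L * C₀) with hd
  have hd0 : 0 < d := by positivity
  have hexp1 : ∀ t, 0 ≤ t → Real.exp (-γ₀ * t) ≤ 1 := fun t ht => by
    rw [Real.exp_le_one_iff]; nlinarith
  have hPle : ∀ t, 0 ≤ t → P t ≤ p + L * C₀ := fun t ht => by
    have h1 := (abs_le.1 (hPp t ht)).2
    have h2 : L * C₀ * Real.exp (-γ₀ * t) ≤ L * C₀ * 1 := by gcongr; exact hexp1 t ht
    linarith
  set v : ℝ → ℝ := fun t => F t - Flim with hv
  set e : ℝ → ℝ := fun t => A * (P t - p) with he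
  have hvd : ∀ t, 0 ≤ t → HasDerivAt v ((e t - v t) / D t) t := fun t ht => by
    refine ((hFd' t ht).sub_const Flim).congr_deriv ?_
    rw [hFeq t ht]
    congr 1
    simp only [he, hv, hFlim]
    ring
  have heb : ∀ t, 0 ≤ t → |e t| ≤ E * Real.exp (-γ₀ * t) := fun t ht => by
    simp only [he]
    rw [abs_mul, abs_of_pos hA0, hE, mul_assoc A]
    exact mul_le_mul_of_nonneg_left (hPp t ht) hA0.le
  set γ := min γ₀ (1 / (2 * d)) with hγ
  have hγ0 : 0 < γ := lt_min hγ₀0 (by positivity)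
  have hγle : γ ≤ γ₀ := min_le_left _ _
  set C₁ := 2 * E + |v 0| + 1 with hC₁
  have hC₁0 : 0 < C₁ := by positivity
  have hvb : ∀ t, 0 ≤ t → |v t| ≤ C₁ * Real.exp (-γ * t) := fun t ht =>
    relaxation_bound hd0 hE0 hvd hD0
      (fun t ht => (hDP t ht).trans (by rw [hd]; gcongr; exact hPle t ht)) heb ht
  have hexpγ : ∀ t, 0 ≤ t → Real.exp (-γ * t) ≤ 1 := fun t ht => by
    rw [Real.exp_le_one_iff]; nlinarith
  set B := 1 + |Flim| + C₁ with hB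
  have hB0 : 0 < B := by positivity
  have hFB : ∀ t, 0 ≤ t → 1 + F t ≤ B := fun t ht => by
    have h1 := (abs_le.1 (hvb t ht)).2
    have h2 : C₁ * Real.exp (-γ * t) ≤ C₁ * 1 := by gcongr; exact hexpγ t ht
    simp only [hv] at h1
    linarith [le_abs_self Flim]
  -- from some time on `P ≥ p / 2`, which bounds `D` from below
  obtain ⟨T, hTp⟩ : ∃ T : ℝ, ∀ t, T ≤ t → L * C₀ * Real.exp (-γ₀ * t) ≤ p / 2 := by
    have h1 : Filter.Tendsto (fun t : ℝ => L * C₀ * Real.exp (-γ₀ * t)) Filter.atTop (nhds 0) := by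
      have h2 : Filter.Tendsto (fun t : ℝ => -γ₀ * t) Filter.atTop Filter.atBot :=
        Filter.tendsto_id.const_mul_atTop_of_neg (by linarith)
      simpa using (Real.tendsto_exp_atBot.comp h2).const_mul (L * C₀)
    exact Filter.eventually_atTop.1 (h1.eventually_le_const (by positivity))
  have hνb : ∀ t, 0 ≤ t → T ≤ t → |κ t - (a + 1 / p) / b| ≤
      ((2 / p ^ 2 * (L * C₀) + (E + C₁) * (2 * B / p)) / b) * Real.exp (-γ * t) := by
    intro t ht hTt
    set X := Real.exp (-γ * t) with hX
    have hX0 : 0 < X := Real.exp_pos _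
    have hXγ : Real.exp (-γ₀ * t) ≤ X := exp_neg_mul_le hγle ht
    have hP1 : p / 2 ≤ P t := by
      have := (abs_le.1 (hPp t ht)).1
      linarith [hTp t hTt]
    have hP0 : 0 < P t := by linarith
    have hDlow : p / (2 * B) ≤ D t := by
      have h1 := hPD t ht
      have h2 : (1 + F t) * D t ≤ B * D t :=
        mul_le_mul_of_nonneg_right (hFB t ht) (hD0 t ht).le
      rw [div_le_iff₀ (by positivity)]
      linarith
    set G := (A * P t + Q - F t) / D t with hG
    have hGb : |G| ≤ (E + C₁) * (2 * B / p) * X := by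
      have h1 : G = (e t - v t) / D t := by
        rw [hG]; congr 1; simp only [he, hv, hFlim]; ring
      have h2 : |e t - v t| ≤ (E + C₁) * X := by
        refine (abs_sub _ _).trans ?_
        have h3 : E * Real.exp (-γ₀ * t) ≤ E * X := by gcongr
        linarith [heb t ht, hvb t ht]
      rw [h1, abs_div, abs_of_pos (hD0 t ht), div_le_iff₀ (hD0 t ht)]
      refine h2.trans ?_
      have h4 : 1 ≤ 2 * B / p * D t := by
        calc (1 : ℝ) = 2 * B / p * (p / (2 * B)) := by field_simp
          _ ≤ _ := by gcongr
      calc (E + C₁) * X = (E + C₁) * X * 1 := by ring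
        _ ≤ (E + C₁) * X * (2 * B / p * D t) := by gcongr
        _ = _ := by ring
    -- `ν P = 1 - T₂ F'`
    have hνP : ν t * P t = 1 - T₂ t * G := by
      have h1 := hbal t ht
      have h2 := hFeq t ht
      rw [← hG] at h2
      simp only [hP]
      linear_combination h1 - T₂ t * h2
    have hT₂P : T₂ t ≤ P t := by
      have := mul_nonneg (hF0 t ht) (hT₂0 t ht)
      simp only [hP]
      linarith [hT₂₁ t ht]
    have hκν : κ t - (a + 1 / p) / b = (ν t - 1 / p) / b := by
      simp only [hν]; field_simp; ring
    have hνd : ν t - 1 / p = (p - P t) / (P t * p) - T₂ t / P t * G := by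
      field_simp
      linear_combination p * hνP
    have h5 : |(p - P t) / (P t * p)| ≤ 2 / p ^ 2 * (L * C₀) * X := by
      rw [abs_div, abs_of_pos (mul_pos hP0 hp), div_le_iff₀ (mul_pos hP0 hp), abs_sub_comm]
      have h6 : 1 ≤ 2 / p ^ 2 * (P t * p) := by
        calc (1 : ℝ) = 2 / p ^ 2 * (p / 2 * p) := by field_simp
          _ ≤ _ := by gcongr
      calc |P t - p| ≤ L * C₀ * Real.exp (-γ₀ * t) := hPp t ht
        _ ≤ L * C₀ * X * 1 := by rw [mul_one]; gcongr
        _ ≤ L * C₀ * X * (2 / p ^ 2 * (P t * p)) := by gcongr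
        _ = _ := by ring
    have h7 : |T₂ t / P t * G| ≤ (E + C₁) * (2 * B / p) * X := by
      rw [abs_mul, abs_of_nonneg (div_nonneg (hT₂0 t ht) hP0.le)]
      calc T₂ t / P t * |G| ≤ 1 * |G| := by
            gcongr
            rw [div_le_one hP0]; exact hT₂P
        _ ≤ _ := by rw [one_mul]; exact hGb
    rw [hκν, abs_div, abs_of_pos hb, div_mul_eq_mul_div]
    gcongr
    rw [hνd]
    refine (abs_sub _ _).trans ?_
    linarith
  obtain ⟨C₂, hC₂, hκb⟩ := exists_exp_bound_of_eventually (hκc.sub continuousOn_const) hγ0 hνb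
  refine ⟨C₀ + C₁ + C₂, γ, by positivity, hγ0, fun t ht => ⟨?_, ?_, ?_⟩⟩
  · refine (hκb t ht).trans ?_
    gcongr
    linarith
  · refine (hvb t ht).trans ?_
    gcongr
    linarith
  · refine (hm t ht).trans ?_
    have := exp_neg_mul_le hγle ht
    gcongr
    linarith

end Convergence

/-! ### The beta function of a transported profile -/

section BetaFunction

variable {p : ℝ}

lemma moebius_pos {s r : ℝ} (hs : 0 < s) (hsr : 0 < s + r) {y : ℝ} (hy : y ∈ Ioc (0 : ℝ) 1) :
    0 < y / (s + r * y) :=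
  div_pos hy.1 (moebius_denom_pos hs hsr ⟨hy.1.le, hy.2⟩)

lemma moebius_monotone {s r : ℝ} (hs : 0 < s) (hsr : 0 < s + r) {u y : ℝ} (hu : 0 ≤ u)
    (huy : u ≤ y) (hy : y ≤ 1) : u / (s + r * u) ≤ y / (s + r * y) := by
  rw [div_le_div_iff₀ (moebius_denom_pos hs hsr ⟨hu, huy.trans hy⟩)
    (moebius_denom_pos hs hsr ⟨hu.trans huy, hy⟩)]
  nlinarith

lemma integral_one_sub_eq {f G : ℝ → ℝ} {y : ℝ} (hy : y ∈ Icc (0 : ℝ) 1)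
    (h : ∀ u ∈ Ioc (0 : ℝ) 1, f (1 - u) = G u) :
    ∫ x in (1 - y)..1, f x = ∫ u in (0 : ℝ)..y, G u := by
  have h1 : ∫ u in (0 : ℝ)..y, f (1 - u) = ∫ x in (1 - y)..1, f x := by
    rw [intervalIntegral.integral_comp_sub_left (fun x => f x) 1, sub_zero]
  rw [← h1]
  refine intervalIntegral.integral_congr_ae (Filter.Eventually.of_forall fun u hu => ?_)
  rw [uIoc_of_le hy.1] at hu
  exact h u ⟨hu.1, hu.2.trans hy.2⟩

lemma deriv_one_sub_eq {f G : ℝ → ℝ} {y : ℝ} (hy : y ∈ Ioo (0 : ℝ) 1)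
    (h : ∀ u ∈ Ioc (0 : ℝ) 1, f (1 - u) = G u) : deriv f (1 - y) = -deriv G y := by
  have hev : f =ᶠ[nhds (1 - y)] fun x => G (1 - x) := by
    filter_upwards [Ioo_mem_nhds (show 0 < 1 - y by linarith [hy.2])
      (show 1 - y < 1 by linarith [hy.1])] with x hx
    rw [← h (1 - x) ⟨by linarith [hx.2], by linarith [hx.1]⟩, sub_sub_cancel]
  rw [hev.deriv_eq, deriv_comp_const_sub, sub_sub_cancel]

/-- The beta function of a profile transported by a Möbius map, in terms of the logarithmic
derivative of the original profile and of its ratios. -/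
lemma betaFn_transported {W g : ℝ → ℝ} {e s r y : ℝ} (he : 0 < e) (hs : 0 < s) (hsr : 0 < s + r)
    (hW : ∀ u ∈ Ioc (0 : ℝ) 1, W (1 - u) = e * g (u / (s + r * u))) (hy : y ∈ Ioo (0 : ℝ) 1)
    (hg0 : 0 < g (y / (s + r * y))) (hd : DifferentiableAt ℝ g (y / (s + r * y))) :
    betaFn W (1 - y) =
      y / (s + r * y) * deriv g (y / (s + r * y)) / g (y / (s + r * y)) *
        (1 / (y * (1 + r / s * y)) *
          ∫ u in (0 : ℝ)..y, g (u / (s + r * u)) / g (y / (s + r * y))) := by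
  have hden := moebius_denom_pos hs hsr (Ioo_subset_Icc_self hy)
  have hy0 := hy.1
  have hderiv : deriv (fun u => e * g (u / (s + r * u))) y =
      e * (deriv g (y / (s + r * y)) * (s / (s + r * y) ^ 2)) :=
    ((hd.hasDerivAt.comp y (hasDerivAt_moebius y hden.ne')).const_mul e).deriv
  have hF : 1 + r / s * y = (s + r * y) / s := by field_simp
  rw [betaFn, deriv_one_sub_eq hy hW, hderiv, integral_one_sub_eq (Ioo_subset_Icc_self hy) hW,
    hW y (Ioo_subset_Ioc_self hy), intervalIntegral.integral_const_mul,
    intervalIntegral.integral_div, hF]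
  set I := ∫ u in (0 : ℝ)..y, g (u / (s + r * u))
  set Γ := g (y / (s + r * y))
  set Γ' := deriv g (y / (s + r * y))
  field_simp

/-- Beta function, divided by `p`, of the transported power profile `(y / (1 + F y)) ^ p`. -/
noncomputable def powerBeta (p F y : ℝ) : ℝ :=
  1 / (y * (1 + F * y)) * ∫ u in (0 : ℝ)..y, (u * (1 + F * y) / (y * (1 + F * u))) ^ p

lemma intervalIntegrable_power_ratio (hp : 0 < p) {F y : ℝ} (hF : 0 ≤ F) (hy : 0 < y) :
    IntervalIntegrable (fun u => (u * (1 + F * y) / (y * (1 + F * u))) ^ p) volume 0 y := by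
  refine ContinuousOn.intervalIntegrable ?_
  rw [uIcc_of_le hy.le]
  refine ContinuousOn.rpow_const (ContinuousOn.div (by fun_prop) (by fun_prop) fun u hu => ?_)
    fun u _ => Or.inr hp.le
  have := hu.1
  positivity

lemma power_ratio_nonneg {F y u : ℝ} (hF : 0 ≤ F) (hy : 0 ≤ y) (hu : 0 ≤ u) :
    0 ≤ u * (1 + F * y) / (y * (1 + F * u)) := by positivity

lemma powerBeta_nonneg {F y : ℝ} (hF : 0 ≤ F) (hy : 0 < y) : 0 ≤ powerBeta p F y :=
  mul_nonneg (by positivity) (intervalIntegral.integral_nonneg hy.le fun _ hu =>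
    Real.rpow_nonneg (power_ratio_nonneg hF hy.le hu.1) p)

lemma powerBeta_le_one (hp : 0 < p) {F y : ℝ} (hF : 0 ≤ F) (hy : 0 < y) :
    powerBeta p F y ≤ 1 := by
  have h1 : ∫ u in (0 : ℝ)..y, (u * (1 + F * y) / (y * (1 + F * u))) ^ p ≤ y := by
    have h := intervalIntegral.integral_mono_on hy.le (intervalIntegrable_power_ratio hp hF hy)
      (intervalIntegrable_const (c := (1 : ℝ)) (μ := volume)) fun u hu => by
        refine Real.rpow_le_one (power_ratio_nonneg hF hy.le hu.1) ?_ hp.le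
        have hu0 := hu.1
        rw [div_le_one (by positivity)]
        nlinarith [hu.2]
    simpa using h
  have hFy : 0 ≤ F * y := by positivity
  rw [powerBeta, one_div_mul_eq_div, div_le_one (by positivity)]
  nlinarith

lemma one_add_mul_le_exp_mul {F G x : ℝ} (hF : 0 ≤ F) (hx : x ∈ Icc (0 : ℝ) 1) :
    1 + G * x ≤ Real.exp |F - G| * (1 + F * x) := by
  have h1 := Real.add_one_le_exp |F - G|
  have h2 : G - F ≤ |F - G| := by rw [abs_sub_comm]; exact le_abs_self _
  have h3 : 0 ≤ F * x := mul_nonneg hF hx.1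
  have h4 : 0 ≤ |F - G| := abs_nonneg _
  calc 1 + G * x ≤ (|F - G| + 1) * (1 + F * x) := by
        nlinarith [mul_le_mul_of_nonneg_right h2 hx.1, mul_le_mul_of_nonneg_left hx.2 h4,
          mul_nonneg h4 h3]
    _ ≤ _ := by gcongr

lemma powerBeta_le_exp_mul (hp : 0 < p) {F G y : ℝ} (hF : 0 ≤ F) (hG : 0 ≤ G)
    (hy : y ∈ Ioc (0 : ℝ) 1) :
    powerBeta p F y ≤ Real.exp ((2 * p + 1) * |F - G|) * powerBeta p G y := by
  set X := Real.exp |F - G| with hX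
  have hX0 : 0 < X := Real.exp_pos _
  have hy0 := hy.1
  have hyI : y ∈ Icc (0 : ℝ) 1 := ⟨hy.1.le, hy.2⟩
  have hXp : Real.exp ((2 * p + 1) * |F - G|) = X * (X ^ 2) ^ p := by
    rw [hX, ← Real.rpow_natCast, ← Real.exp_mul, ← Real.exp_mul, ← Real.exp_add]
    congr 1
    push_cast
    ring
  have h1 : 1 / (y * (1 + F * y)) ≤ X * (1 / (y * (1 + G * y))) := by
    have h := one_add_mul_le_exp_mul (G := G) hF hyI
    rw [mul_one_div, div_le_div_iff₀ (by positivity) (by positivity)]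
    calc 1 * (y * (1 + G * y)) ≤ y * (X * (1 + F * y)) := by rw [one_mul]; gcongr
      _ = _ := by ring
  have h2 : ∫ u in (0 : ℝ)..y, (u * (1 + F * y) / (y * (1 + F * u))) ^ p ≤
      (X ^ 2) ^ p * ∫ u in (0 : ℝ)..y, (u * (1 + G * y) / (y * (1 + G * u))) ^ p := by
    rw [← intervalIntegral.integral_const_mul]
    refine intervalIntegral.integral_mono_on hy.1.le (intervalIntegrable_power_ratio hp hF hy.1)
      ((intervalIntegrable_power_ratio hp hG hy.1).const_mul _) fun u hu => ?_
    have hu0 := hu.1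
    rw [← Real.mul_rpow (by positivity) (power_ratio_nonneg hG hy.1.le hu.1)]
    refine Real.rpow_le_rpow (power_ratio_nonneg hF hy.1.le hu.1) ?_ hp.le
    have h3 := one_add_mul_le_exp_mul (F := G) (G := F) hG hyI
    have h4 := one_add_mul_le_exp_mul (F := F) (G := G) hF
      (x := u) ⟨hu.1, hu.2.trans hy.2⟩
    rw [abs_sub_comm] at h3
    rw [mul_div_assoc', div_le_div_iff₀ (by positivity) (by positivity)]
    calc u * (1 + F * y) * (y * (1 + G * u))
        ≤ u * (X * (1 + G * y)) * (y * (X * (1 + F * u))) := by gcongr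
      _ = _ := by ring
  have h5 : 0 ≤ ∫ u in (0 : ℝ)..y, (u * (1 + F * y) / (y * (1 + F * u))) ^ p :=
    intervalIntegral.integral_nonneg hy.1.le fun _ hu =>
      Real.rpow_nonneg (power_ratio_nonneg hF hy.1.le hu.1) p
  rw [hXp, powerBeta, powerBeta]
  calc _ ≤ (X * (1 / (y * (1 + G * y)))) * ((X ^ 2) ^ p *
        ∫ u in (0 : ℝ)..y, (u * (1 + G * y) / (y * (1 + G * u))) ^ p) := by gcongr
    _ = _ := by ring

/-- Passage from a relative to an absolute error. -/
lemma abs_sub_le_of_le_exp_mul {A B x : ℝ} (hx : 0 ≤ x) (hB0 : 0 ≤ B) (hB : B ≤ 1)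
    (h1 : A ≤ Real.exp x * B) (h2 : B ≤ Real.exp x * A) : |A - B| ≤ x * Real.exp x := by
  have hE := Real.exp_pos x
  have h3 : Real.exp x - 1 ≤ x * Real.exp x := by
    have h4 := Real.add_one_le_exp (-x)
    have h5 : Real.exp (-x) * Real.exp x = 1 := by rw [← Real.exp_add]; simp
    nlinarith
  have h6 : 1 ≤ Real.exp x := Real.one_le_exp hx
  have h7 : (Real.exp x - 1) * B ≤ Real.exp x - 1 := by nlinarith
  rw [abs_le]
  constructor
  · have h8 : Real.exp (-x) * B ≤ A := by
      rw [Real.exp_neg, inv_mul_le_iff₀ hE]; exact h2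
    have h9 : 1 - x ≤ Real.exp (-x) := by linarith [Real.add_one_le_exp (-x)]
    nlinarith [mul_le_mul_of_nonneg_right h9 hB0, mul_le_mul_of_nonneg_left hB hx,
      mul_le_mul_of_nonneg_left h6 hx]
  · linarith

lemma abs_powerBeta_sub_le (hp : 0 < p) {F G y : ℝ} (hF : 0 ≤ F) (hG : 0 ≤ G)
    (hy : y ∈ Ioc (0 : ℝ) 1) :
    |powerBeta p F y - powerBeta p G y| ≤
      (2 * p + 1) * |F - G| * Real.exp ((2 * p + 1) * |F - G|) := by
  refine abs_sub_le_of_le_exp_mul (by positivity) (powerBeta_nonneg hG hy.1)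
    (powerBeta_le_one hp hG hy.1) (powerBeta_le_exp_mul hp hF hG hy) ?_
  rw [abs_sub_comm]
  exact powerBeta_le_exp_mul hp hG hF hy

/-- The beta function of a transported profile, compared with that of the transported power. The
error is controlled by the size of the part of the original profile that is still visible. -/
lemma BoundaryProfile.abs_beta_sub_le {g : ℝ → ℝ} (hg : BoundaryProfile g) {L α : ℝ} (hα : 0 < α)
    (hL : 0 < L) (hp : 0 < p)
    (hlog : ∀ᵐ z, z ∈ Ioo (0 : ℝ) 1 → |z * deriv g z - p * g z| ≤ L * z ^ α * g z)
    {s r y : ℝ} (hs : 0 < s) (hr : 0 ≤ r) (hsr : 1 ≤ s + r) (hy : y ∈ Ioo (0 : ℝ) 1)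
    (hZ : |y / (s + r * y) * deriv g (y / (s + r * y)) - p * g (y / (s + r * y))| ≤
      L * (y / (s + r * y)) ^ α * g (y / (s + r * y))) :
    |y / (s + r * y) * deriv g (y / (s + r * y)) / g (y / (s + r * y)) *
        (1 / (y * (1 + r / s * y)) *
          ∫ u in (0 : ℝ)..y, g (u / (s + r * u)) / g (y / (s + r * y))) -
      p * powerBeta p (r / s) y| ≤
    L * (1 + p / α) * Real.exp (L / α) * (1 / (s + r)) ^ α := by
  have hsr0 : 0 < s + r := by linarith
  set m := 1 / (s + r) with hm
  have hm0 : 0 < m := by positivity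
  have hm1 : m ≤ 1 := by rw [hm, div_le_one hsr0]; exact hsr
  have hmα0 : 0 ≤ m ^ α := by positivity
  have hmα1 : m ^ α ≤ 1 := Real.rpow_le_one hm0.le hm1 hα.le
  set F := r / s with hF
  have hF0 : 0 ≤ F := by positivity
  have hy0 := hy.1
  have hyI : y ∈ Ioc (0 : ℝ) 1 := Ioo_subset_Ioc_self hy
  set Z := y / (s + r * y) with hZdef
  have hZ0 : 0 < Z := moebius_pos hs hsr0 hyI
  have hZm : Z ≤ m := by
    have := moebius_monotone hs hsr0 hy.1.le hy.2.le le_rfl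
    rwa [mul_one] at this
  have hZα : Z ^ α ≤ m ^ α := by gcongr
  have hgZ := hg.pos Z hZ0
  set θ := Z * deriv g Z / g Z with hθ
  have hθp : |θ - p| ≤ L * m ^ α := by
    have h1 : θ - p = (Z * deriv g Z - p * g Z) / g Z := by rw [hθ]; field_simp
    rw [h1, abs_div, abs_of_pos hgZ, div_le_iff₀ hgZ]
    refine hZ.trans ?_
    gcongr
  set J := 1 / (y * (1 + F * y)) * ∫ u in (0 : ℝ)..y, g (u / (s + r * u)) / g Z with hJ
  set x := L / α * m ^ α with hx
  have hx0 : 0 ≤ x := by positivity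
  have hxL : x ≤ L / α := by
    calc x ≤ L / α * 1 := by rw [hx]; gcongr
      _ = L / α := mul_one _
  -- pointwise comparison of the ratios of `g` with powers
  have hratio : ∀ u ∈ Ioc 0 y,
      g (u / (s + r * u)) / g Z ≤ Real.exp x * (u * (1 + F * y) / (y * (1 + F * u))) ^ p ∧
      (u * (1 + F * y) / (y * (1 + F * u))) ^ p ≤ Real.exp x * (g (u / (s + r * u)) / g Z) := by
    intro u hu
    have hu1 : u ∈ Ioc (0 : ℝ) 1 := ⟨hu.1, hu.2.trans hyI.2⟩
    have hu0 := hu.1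
    have hZu0 := moebius_pos hs hsr0 hu1
    have hZuZ := moebius_monotone hs hsr0 hu.1.le hu.2 hyI.2
    have hgu := hg.pos _ hZu0
    have h1 := hg.abs_log_div_sub_le hα hL hlog hZu0 hZuZ (hZm.trans hm1)
    have h2 := h1.trans (show L / α * Z ^ α ≤ x by rw [hx]; gcongr)
    have e1 : u * (1 + F * y) / (y * (1 + F * u)) = u / (s + r * u) / Z := by
      rw [hZdef, hF]
      field_simp
    rw [e1]
    rw [← hZdef] at h2
    set Zu := u / (s + r * u) with hZu
    rw [Real.log_div hgZ.ne' hgu.ne', Real.log_div hZ0.ne' hZu0.ne'] at h2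
    have h3 := abs_le.1 h2
    have e2 : (Zu / Z) ^ p = Real.exp ((Real.log Zu - Real.log Z) * p) := by
      rw [Real.rpow_def_of_pos (by positivity), Real.log_div hZu0.ne' hZ0.ne']
    have e3 : g Zu / g Z = Real.exp (Real.log (g Zu) - Real.log (g Z)) := by
      rw [Real.exp_sub, Real.exp_log hgu, Real.exp_log hgZ]
    rw [e2, e3, ← Real.exp_add, ← Real.exp_add, Real.exp_le_exp, Real.exp_le_exp]
    constructor <;> linarith
  have hi1 : IntervalIntegrable (fun u => g (u / (s + r * u)) / g Z) volume 0 y := by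
    refine ContinuousOn.intervalIntegrable ?_
    rw [uIcc_of_le hy.1.le]
    refine (hg.continuous.comp_continuousOn
      (ContinuousOn.div (by fun_prop) (by fun_prop) fun u hu => ?_)).div_const _
    exact (moebius_denom_pos hs hsr0 ⟨hu.1, hu.2.trans hy.2.le⟩).ne'
  have hi2 := intervalIntegrable_power_ratio hp hF0 hy.1
  have hpre : 0 ≤ 1 / (y * (1 + F * y)) := by positivity
  have hJ1 : J ≤ Real.exp x * powerBeta p F y := by
    rw [hJ, powerBeta, mul_left_comm, ← intervalIntegral.integral_const_mul (Real.exp x)]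
    refine mul_le_mul_of_nonneg_left ?_ hpre
    exact intervalIntegral.integral_mono_on_of_le_Ioo hy.1.le hi1 (hi2.const_mul _)
      fun u hu => (hratio u (Ioo_subset_Ioc_self hu)).1
  have hJ2 : powerBeta p F y ≤ Real.exp x * J := by
    rw [hJ, powerBeta, mul_left_comm, ← intervalIntegral.integral_const_mul (Real.exp x)]
    refine mul_le_mul_of_nonneg_left ?_ hpre
    exact intervalIntegral.integral_mono_on_of_le_Ioo hy.1.le hi2 (hi1.const_mul _)
      fun u hu => (hratio u (Ioo_subset_Ioc_self hu)).2
  clear_value J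
  have hB0 := powerBeta_nonneg (p := p) hF0 hy.1
  have hB1 := powerBeta_le_one hp hF0 hy.1
  have hexp : Real.exp x ≤ Real.exp (L / α) := Real.exp_le_exp.2 hxL
  have hJB := abs_sub_le_of_le_exp_mul hx0 hB0 hB1 hJ1 hJ2
  have hJ0 : 0 ≤ J := by
    have := Real.exp_pos x
    by_contra hneg
    push Not at hneg
    nlinarith
  have hJle : J ≤ Real.exp (L / α) := by
    calc J ≤ Real.exp x * 1 := hJ1.trans (by gcongr)
      _ ≤ _ := by rw [mul_one]; exact hexp
  have e : θ * J - p * powerBeta p F y = (θ - p) * J + p * (J - powerBeta p F y) := by ring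
  rw [e]
  refine (abs_add_le _ _).trans ?_
  rw [abs_mul, abs_mul, abs_of_nonneg hJ0, abs_of_pos hp]
  calc |θ - p| * J + p * |J - powerBeta p F y|
      ≤ L * m ^ α * Real.exp (L / α) + p * (x * Real.exp (L / α)) := by
        gcongr
        refine hJB.trans ?_
        gcongr
    _ = _ := by rw [hx]; field_simp

/-- Preimages of full measure sets under the Möbius map have full measure. -/
lemma ae_comp_moebius {s r : ℝ} (hs : 0 < s) (hsr : 1 ≤ s + r) {P : ℝ → Prop}
    (h : ∀ᵐ z, z ∈ Ioo (0 : ℝ) 1 → P z) :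
    ∀ᵐ y, y ∈ Ioo (0 : ℝ) 1 → P (y / (s + r * y)) := by
  have hsr0 : 0 < s + r := by linarith
  set N : Set ℝ := {z | ¬(z ∈ Ioo (0 : ℝ) 1 → P z)} ∩ Icc 0 (1 / (s + r)) with hN
  have hN0 : volume N = 0 := measure_mono_null inter_subset_left (ae_iff.1 h)
  have himg := MeasureTheory.addHaar_image_eq_zero_of_differentiableOn_of_addHaar_eq_zero volume
    (f := fun z => s * z / (1 - r * z)) (s := N) (fun z hz =>
      (hasDerivAt_moebius_inv z
        (moebius_inv_denom_pos hs hsr0 hz.2).ne').differentiableAt.differentiableWithinAt) hN0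
  rw [ae_iff]
  refine measure_mono_null ?_ himg
  intro y hy
  simp only [mem_ofPred_eq, Classical.not_imp] at hy
  obtain ⟨hy1, hyP⟩ := hy
  have hden := moebius_denom_pos hs hsr0 (Ioo_subset_Icc_self hy1)
  have hZ0 := moebius_pos hs hsr0 (Ioo_subset_Ioc_self hy1)
  have hZm : y / (s + r * y) < 1 / (s + r) := by
    rw [div_lt_div_iff₀ hden hsr0]
    nlinarith [hy1.2]
  have hm1 : 1 / (s + r) ≤ 1 := by rw [div_le_one hsr0]; exact hsr
  refine ⟨y / (s + r * y), ⟨fun hc => hyP (hc ⟨hZ0, hZm.trans_le hm1⟩), hZ0.le, hZm.le⟩, ?_⟩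
  have e : 1 - r * (y / (s + r * y)) = s / (s + r * y) := by field_simp; ring
  beta_reduce
  rw [e, ← mul_div_assoc, div_div_div_cancel_right₀ hden.ne', mul_div_cancel_left₀ _ hs.ne']

lemma ae_one_sub {P : ℝ → Prop} (h : ∀ᵐ y, P y) : ∀ᵐ x : ℝ, P (1 - x) :=
  (Measure.measurePreserving_sub_left volume (1 : ℝ)).quasiMeasurePreserving.ae h

end BetaFunction

/-! ### The stationary solution and the convergence theorem -/

section Stationary

variable {a b q p : ℝ} {φ ψ : ℝ → ℝ}

/-- The profile of the stationary solution, up to normalization. -/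
noncomputable def stationaryShape (p F x : ℝ) : ℝ := ((1 - x) / (1 + F * (1 - x))) ^ p

lemma stationaryShape_one_sub (p F y : ℝ) : stationaryShape p F (1 - y) = (y / (1 + F * y)) ^ p := by
  rw [stationaryShape, sub_sub_cancel]

lemma continuousOn_stationaryShape (hp : 0 < p) {F : ℝ} (hF : 0 ≤ F) :
    ContinuousOn (stationaryShape p F) (Icc 0 1) := by
  refine ContinuousOn.rpow_const (ContinuousOn.div (by fun_prop) (by fun_prop) fun x hx => ?_)
    fun x _ => Or.inr hp.le
  have : 0 ≤ 1 - x := by linarith [hx.2]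
  positivity

lemma stationaryShape_pos (p : ℝ) {F x : ℝ} (hF : 0 ≤ F) (hx : x ∈ Ico (0 : ℝ) 1) :
    0 < stationaryShape p F x := by
  have : 0 < 1 - x := by linarith [hx.2]
  rw [stationaryShape]
  positivity

/-- The stationary equation `(φ - κ ψ) W' = W`, with
`φ(1 - y) - κ ψ(1 - y) = -(y / p) (1 + F y)`. -/
lemma hasDerivAt_stationaryShape (hp : 0 < p) {F x : ℝ} (hF : 0 ≤ F) (hx : x ∈ Ico (0 : ℝ) 1) :
    HasDerivAt (stationaryShape p F)
      (-(stationaryShape p F x / ((1 - x) / p * (1 + F * (1 - x))))) x := by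
  have hy : 0 < 1 - x := by linarith [hx.2]
  have hden : 0 < 1 + F * (1 - x) := by positivity
  have h1 : HasDerivAt (fun x : ℝ => 1 - x) (-1) x := by
    simpa using (hasDerivAt_id x).const_sub 1
  have h2 := ((hasDerivAt_moebius (s := 1) (r := F) (1 - x) hden.ne').comp x h1).rpow_const
    (p := p) (Or.inl (div_pos hy hden).ne')
  refine h2.congr_deriv ?_
  simp only [Function.comp]
  rw [Real.rpow_sub_one (div_pos hy hden).ne', stationaryShape]
  field_simp

lemma integral_stationaryShape_pos (hp : 0 < p) {F : ℝ} (hF : 0 ≤ F) :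
    0 < ∫ x in (0 : ℝ)..1, stationaryShape p F x :=
  intervalIntegral.intervalIntegral_pos_of_pos_on
    (ContinuousOn.intervalIntegrable (by
      rw [uIcc_of_le zero_le_one]; exact continuousOn_stationaryShape hp hF))
    (fun _ hx => stationaryShape_pos p hF (Ioo_subset_Ico_self hx)) one_pos

/-- The normalized stationary profile. -/
noncomputable def stationaryProfile (p F x : ℝ) : ℝ :=
  (∫ x in (0 : ℝ)..1, stationaryShape p F x)⁻¹ * stationaryShape p F x

lemma isStationarySolution_stationaryProfile (hM : IsModel a b q φ ψ) (hp : 0 < p) {F : ℝ}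
    (hFeq : F = a * (1 + q / b) * p + q / b) :
    IsStationarySolution φ ψ ((a + 1 / p) / b) (stationaryProfile p F) := by
  have ha := hM.a_pos
  have hb := hM.b_pos
  have hq := hM.q_nonneg
  have hF : 0 ≤ F := by rw [hFeq]; positivity
  have hI := integral_stationaryShape_pos hp hF
  set c := (∫ x in (0 : ℝ)..1, stationaryShape p F x)⁻¹ with hc
  have hc0 : 0 < c := inv_pos.2 hI
  have hcont : ContinuousOn (stationaryProfile p F) (Icc 0 1) :=
    continuousOn_const.mul (continuousOn_stationaryShape hp hF)
  have hpos : ∀ x ∈ Ico (0 : ℝ) 1, 0 < stationaryProfile p F x := fun x hx =>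
    mul_pos hc0 (stationaryShape_pos p hF hx)
  have hder : ∀ x ∈ Ico (0 : ℝ) 1, HasDerivAt (stationaryProfile p F)
      (-(stationaryProfile p F x / ((1 - x) / p * (1 + F * (1 - x))))) x := fun x hx => by
    refine ((hasDerivAt_stationaryShape hp hF hx).const_mul c).congr_deriv ?_
    rw [stationaryProfile, ← hc]
    ring
  have hvel : ∀ x, φ x - (a + 1 / p) / b * ψ x = -((1 - x) / p * (1 + F * (1 - x))) := fun x => by
    have h1 := hM.phi_eq (1 - x)
    have h2 := hM.psi_eq (1 - x)
    rw [sub_sub_cancel] at h1 h2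
    rw [h1, h2, hFeq]
    field_simp
    ring
  have hone : stationaryProfile p F 1 = 0 := by
    rw [stationaryProfile, stationaryShape, sub_self, zero_div, Real.zero_rpow hp.ne', mul_zero]
  refine ⟨⟨⟨fun x => stationaryProfile p F x / ((1 - x) / p * (1 + F * (1 - x))), ?_, ?_, ?_⟩,
    hpos⟩, continuousOn_const, ?_, ?_, ?_⟩
  · have h := intervalIntegral.integrableOn_deriv_of_nonneg (a := 0) (b := 1)
      (g := fun x => -stationaryProfile p F x)
      (g' := fun x => stationaryProfile p F x / ((1 - x) / p * (1 + F * (1 - x)))) hcont.neg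
      (fun x hx => (hder x (Ioo_subset_Ico_self hx)).fun_neg.congr_deriv (neg_neg _)) (fun x hx => by
        have := (hpos x (Ioo_subset_Ico_self hx)).le
        have : 0 ≤ 1 - x := by linarith [hx.2]
        positivity)
    exact h.mono_set Ioo_subset_Ioc_self
  · intro x hx
    have := (hpos x (Ioo_subset_Ico_self hx)).le
    have : 0 ≤ 1 - x := by linarith [hx.2]
    positivity
  · intro x hx
    have hsub : Icc x 1 ⊆ Icc 0 1 := Icc_subset_Icc_left hx.1
    have hdx : ∀ u ∈ Ioo x 1, HasDerivAt (fun x => -stationaryProfile p F x)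
        (stationaryProfile p F u / ((1 - u) / p * (1 + F * (1 - u)))) u := fun u hu =>
      (hder u ⟨hx.1.trans hu.1.le, hu.2⟩).fun_neg.congr_deriv (neg_neg _)
    have hint := intervalIntegral.integrableOn_deriv_of_nonneg (a := x) (b := 1)
      (g := fun x => -stationaryProfile p F x)
      (g' := fun x => stationaryProfile p F x / ((1 - x) / p * (1 + F * (1 - x))))
      (hcont.mono hsub).neg hdx (fun u hu => by
        have := (hpos u ⟨hx.1.trans hu.1.le, hu.2⟩).le
        have : 0 ≤ 1 - u := by linarith [hu.2]
        positivity)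
    have h := intervalIntegral.integral_eq_sub_of_hasDerivAt_of_le hx.2.le
      (hcont.mono hsub).neg hdx
      ((intervalIntegrable_iff_integrableOn_Ioc_of_le hx.2.le).2 hint)
    rw [h, Pi.neg_apply, Pi.neg_apply, hone]
    ring
  · exact (hcont.mono Ico_subset_Icc_self).comp continuousOn_fst fun x hx => hx.1
  · intro X t₁ t₂ _ hX t ht
    obtain ⟨hXt, hXd⟩ := hX t ht
    have hy : 0 < 1 - X t := by linarith [hXt.2]
    refine ((hder (X t) hXt).comp_hasDerivWithinAt t hXd).congr_deriv ?_
    rw [hvel]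
    have : 0 < 1 + F * (1 - X t) := by positivity
    field_simp
  · intro t _
    simp only [stationaryProfile]
    rw [intervalIntegral.integral_const_mul, ← hc]
    exact inv_mul_cancel₀ hI.ne'

/-- Every stationary solution is transported along the characteristic through `x = 0`, which
sweeps the whole interval; this determines it up to a factor, and the mass determines the factor. -/
lemma IsStationarySolution.eqOn_stationaryProfile (hM : IsModel a b q φ ψ) (hp : 0 < p) {F : ℝ}
    (hFeq : F = a * (1 + q / b) * p + q / b) {V : ℝ → ℝ}
    (hV : IsStationarySolution φ ψ ((a + 1 / p) / b) V) :
    EqOn V (stationaryProfile p F) (Ico 0 1) := by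
  have ha := hM.a_pos
  have hb := hM.b_pos
  have hq := hM.q_nonneg
  have hF : 0 ≤ F := by rw [hFeq]; positivity
  set s : ℝ → ℝ := fun t => Real.exp (t / p) with hs
  set r : ℝ → ℝ := fun t => F * (Real.exp (t / p) - 1) with hr
  have hsd : ∀ t, HasDerivAt s (1 / p * s t) t := fun t => by
    have := ((hasDerivAt_id t).div_const p).exp
    rw [mul_comm]
    exact this
  have hf : IsRiccatiFlow a b q (fun _ => (a + 1 / p) / b) s r := by
    refine ⟨by simp [hs], by simp [hr], fun t => Real.exp_pos _, fun t _ => ?_, fun t _ => ?_⟩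
    · refine (hsd t).congr_deriv ?_
      field_simp
      ring
    · refine (((hsd t).sub_const 1).const_mul F).congr_deriv ?_
      rw [hFeq]
      field_simp
      ring
  obtain ⟨g, hg, hg0⟩ := hV.initial.exists_boundaryProfile
  have hT := hV.isTransported hM hf hg hg0
  have hshape : ∀ y ∈ Ioc (0 : ℝ) 1,
      V (1 - y) = V 0 * (1 + F) ^ p * stationaryShape p F (1 - y) := by
    intro y hy
    have hy0 := hy.1
    set t := p * Real.log ((1 / y + F) / (1 + F)) with ht
    have hge : 1 ≤ (1 / y + F) / (1 + F) := by
      rw [le_div_iff₀ (by positivity)]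
      have : 1 ≤ 1 / y := by rw [le_div_iff₀ hy.1]; linarith [hy.2]
      linarith
    have ht0 : 0 ≤ t := mul_nonneg hp.le (Real.log_nonneg hge)
    have hst : s t = (1 / y + F) / (1 + F) := by
      simp only [hs, ht]
      rw [mul_div_cancel_left₀ _ hp.ne', Real.exp_log (by positivity)]
    have hsr : s t + r t = 1 / y := by
      have : r t = F * (s t - 1) := rfl
      rw [this, hst]
      field_simp
      ring
    have h := hT.eq_profile t ht0 1 ⟨one_pos, le_rfl⟩
    rw [mul_one, hsr, one_div_one_div, sub_self, ← hg0 y hy] at h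
    have hE : Real.exp t = ((1 / y + F) / (1 + F)) ^ p := by
      rw [ht, Real.rpow_def_of_pos (by positivity), mul_comm]
    have hE2 : Real.exp t * ((1 + F) ^ p * (y / (1 + F * y)) ^ p) = 1 := by
      rw [hE, ← Real.mul_rpow (by positivity) (by positivity),
        ← Real.mul_rpow (by positivity) (by positivity)]
      have : (1 / y + F) / (1 + F) * ((1 + F) * (y / (1 + F * y))) = 1 := by
        field_simp
      rw [this, Real.one_rpow]
    rw [stationaryShape_one_sub, h]
    linear_combination (-V (1 - y)) * hE2
  have hI := integral_stationaryShape_pos hp hF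
  have hmass : V 0 * (1 + F) ^ p * ∫ x in (0 : ℝ)..1, stationaryShape p F x = 1 := by
    refine Eq.trans ?_ (hV.mass 0 le_rfl)
    rw [← integral_comp_one_sub V, ← integral_comp_one_sub (stationaryShape p F),
      ← intervalIntegral.integral_const_mul]
    refine intervalIntegral.integral_congr_ae (Filter.Eventually.of_forall fun y hy => ?_)
    rw [uIoc_of_le zero_le_one] at hy
    exact (hshape y hy).symm
  intro x hx
  have h := hshape (1 - x) ⟨by linarith [hx.2], by linarith [hx.1]⟩
  rw [sub_sub_cancel] at h
  rw [h, stationaryProfile, eq_inv_of_mul_eq_one_left hmass]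

lemma betaFn_stationaryProfile (hp : 0 < p) {F y : ℝ} (hF : 0 ≤ F) (hy : y ∈ Ioo (0 : ℝ) 1) :
    betaFn (stationaryProfile p F) (1 - y) = p * powerBeta p F y := by
  have hc0 : 0 < (∫ x in (0 : ℝ)..1, stationaryShape p F x)⁻¹ :=
    inv_pos.2 (integral_stationaryShape_pos hp hF)
  have hy0 := hy.1
  have hZ : 0 < y / (1 + F * y) := by positivity
  have hd := Real.hasDerivAt_rpow_const (p := p) (Or.inl hZ.ne')
  rw [betaFn_transported (g := fun z => z ^ p) (s := 1) (r := F) hc0 one_pos (by linarith)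
    (fun u _ => by rw [stationaryProfile, stationaryShape_one_sub]) hy (by positivity)
    hd.differentiableAt, hd.deriv, div_one, powerBeta, Real.rpow_sub_one hZ.ne']
  congr 1
  · have : (y / (1 + F * y)) ^ p ≠ 0 := by positivity
    field_simp
  · congr 1
    refine intervalIntegral.integral_congr fun u hu => ?_
    rw [uIcc_of_le hy.1.le] at hu
    have hu0 := hu.1
    rw [← Real.div_rpow (by positivity) hZ.le]
    congr 1
    field_simp

end Stationary

section Coefficients

lemma Polynomial.eval_eq_of_natDegree_le_two {P : ℝ[X]} (h : P.natDegree ≤ 2) :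
    (∀ x, P.eval x = P.coeff 0 + P.coeff 1 * x + P.coeff 2 * x ^ 2) ∧
      P.derivative.eval 1 = P.coeff 1 + 2 * P.coeff 2 := by
  have hP : P = C (P.coeff 0) + C (P.coeff 1) * X + C (P.coeff 2) * X ^ 2 := by
    conv_lhs => rw [P.as_sum_range_C_mul_X_pow' (n := 3) (by omega)]
    simp [Finset.sum_range_succ]
  constructor
  · intro x
    conv_lhs => rw [hP]
    simp
  · conv_lhs => rw [hP]
    simp
    ring

lemma QuadraticCoefficients.isModel {φ ψ : ℝ[X]} (h : QuadraticCoefficients φ ψ) :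
    IsModel (-φ.derivative.eval 1) (-ψ.derivative.eval 1) (ψ.coeff 2) (fun x => φ.eval x)
      (fun x => ψ.eval x) := by
  obtain ⟨hφ, hφ'⟩ := Polynomial.eval_eq_of_natDegree_le_two h.natDegree_phi
  obtain ⟨hψ, hψ'⟩ := Polynomial.eval_eq_of_natDegree_le_two h.natDegree_psi
  have e1 := h.phi_zero
  have e2 := h.phi_one
  have e3 := h.psi_one
  rw [hφ] at e1 e2
  rw [hψ] at e3
  refine ⟨fun y => ?_, fun y => ?_, by linarith [h.deriv_phi_neg], by linarith [h.deriv_psi_neg],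
    ?_⟩
  · simp only [hφ, hφ']
    linear_combination (1 - y ^ 2) * e2 + y ^ 2 * e1
  · simp only [hψ, hψ']
    linear_combination e3
  · have hc := h.convex_psi.2 (x := 0) (y := 1) ⟨le_rfl, zero_le_one⟩ ⟨zero_le_one, le_rfl⟩
      (show (0 : ℝ) ≤ 1 / 2 by norm_num) (show (0 : ℝ) ≤ 1 / 2 by norm_num) (by norm_num)
    simp only [hψ, smul_eq_mul] at hc
    norm_num at hc
    linarith

end Coefficients

theorem proposition3p1 (φ ψ : ℝ[X]) (hφψ : QuadraticCoefficients φ ψ)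
    (w : ℝ → ℝ → ℝ) (κ : ℝ → ℝ)
    (hw : IsSolution (fun x => φ.eval x) (fun x => ψ.eval x) w κ)
    (β₀ : ℝ) (hβ₀_pos : 0 < β₀) (hβ₀_lt : β₀ < 1)
    (hβ : HolderAtOne (betaFn (fun x => w x 0)) β₀)
    (κlim : ℝ)
    (hκlim : κlim = (1 / β₀ - φ.derivative.eval 1 - 1) / |ψ.derivative.eval 1|) :
    ∃ W : ℝ → ℝ,
      IsStationarySolution (fun x => φ.eval x) (fun x => ψ.eval x) κlim W ∧
      (∀ V : ℝ → ℝ, IsStationarySolution (fun x => φ.eval x) (fun x => ψ.eval x) κlim V →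
        EqOn V W (Ico 0 1)) ∧
      ∃ C γ : ℝ, 0 < C ∧ 0 < γ ∧ ∀ t : ℝ, 0 ≤ t →
        |κ t - κlim| ≤ C * Real.exp (-γ * t) ∧
        eLpNorm (fun x => betaFn (fun y => w y t) x - betaFn W x) ⊤
            (volume.restrict (Ioo (0 : ℝ) 1)) ≤
          ENNReal.ofReal (C * Real.exp (-γ * t)) := by
  have hM := hφψ.isModel
  set a := -φ.derivative.eval 1 with ha
  set b := -ψ.derivative.eval 1 with hb
  set q := ψ.coeff 2
  have ha0 := hM.a_pos
  have hb0 := hM.b_pos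
  have hq0 := hM.q_nonneg
  set p := β₀ / (1 - β₀) with hp
  have h1β : 0 < 1 - β₀ := by linarith
  have hp0 : 0 < p := by positivity
  have hκeq : κlim = (a + 1 / p) / b := by
    have habs : |ψ.derivative.eval 1| = b := by
      rw [hb, abs_of_neg]
      linarith
    rw [hκlim, habs, hp, ha]
    congr 1
    field_simp
    ring
  set F := a * (1 + q / b) * p + q / b with hF
  have hF0 : 0 ≤ F := by positivity
  rw [hκeq]
  refine ⟨stationaryProfile p F, isStationarySolution_stationaryProfile hM hp0 hF,
    fun V hV => hV.eqOn_stationaryProfile hM hp0 hF, ?_⟩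
  obtain ⟨g, hg, hg0⟩ := hw.initial.exists_boundaryProfile
  obtain ⟨s, r, hf⟩ := exists_isRiccatiFlow a b q hw.continuousOn_kappa
  have hT := hw.isTransported hM hf hg hg0
  -- the Hölder condition in the coordinate `z = 1 - x`
  obtain ⟨K, α, hα, hK⟩ := hβ
  rw [ae_restrict_iff' measurableSet_Ioo] at hK
  have hβg : ∀ᵐ z, z ∈ Ioo (0 : ℝ) 1 →
      |deriv g z * (∫ u in (0 : ℝ)..z, g u) / g z ^ 2 - β₀| ≤ K * z ^ α := by
    filter_upwards [ae_one_sub hK] with z hz hz1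
    have h := hz ⟨by linarith [hz1.2], by linarith [hz1.1]⟩
    rwa [betaFn, deriv_one_sub_eq hz1 hg0, neg_neg, sub_sub_cancel,
      integral_one_sub_eq (Ioo_subset_Icc_self hz1) hg0, hg0 z (Ioo_subset_Ioc_self hz1)] at h
  obtain ⟨L, hL, hlog⟩ := hg.exists_abs_logDeriv_le hβ₀_pos hβ₀_lt hα hβg
  obtain ⟨C, γ, hC, hγ, hconv⟩ :=
    hT.exists_convergence hM hw.continuousOn_kappa hf hg hα hL hp0 hlog
  set C₁ := L * (1 + p / α) * Real.exp (L / α) with hC₁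
  set C₂ := p * ((2 * p + 1) * Real.exp ((2 * p + 1) * C)) with hC₂
  have hC₁0 : 0 < C₁ := by positivity
  have hC₂0 : 0 < C₂ := by positivity
  refine ⟨C + C₁ * C + C₂ * C, γ, by positivity, hγ, fun t ht => ?_⟩
  obtain ⟨hκt, hFt, hmt⟩ := hconv t ht
  have hX0 := Real.exp_pos (-γ * t)
  have hX1 : Real.exp (-γ * t) ≤ 1 := by rw [Real.exp_le_one_iff]; nlinarith
  set X := Real.exp (-γ * t) with hX
  have hCC₁ : 0 ≤ C₁ * C := by positivity
  have hCC₂ : 0 ≤ C₂ * C := by positivity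
  refine ⟨hκt.trans (by gcongr; linarith), ?_⟩
  have hs := hf.s_pos t
  have hsr := hT.one_le t ht
  have hr := hT.r_nonneg t ht
  -- the points at which the transported profile is differentiable and the bound on its
  -- logarithmic derivative holds
  have hgood := ae_comp_moebius hs hsr (P := fun z => DifferentiableAt ℝ g z ∧
      |z * deriv g z - p * g z| ≤ L * z ^ α * g z) (by
    filter_upwards [hg.ae_differentiableAt, hlog] with z h1 h2 hz using ⟨h1 hz, h2 hz⟩)
  rw [eLpNorm_exponent_top]
  refine eLpNormEssSup_le_of_ae_bound ?_
  rw [ae_restrict_iff' measurableSet_Ioo]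
  filter_upwards [ae_one_sub hgood] with x hx hx1
  have hy : 1 - x ∈ Ioo (0 : ℝ) 1 := ⟨by linarith [hx1.2], by linarith [hx1.1]⟩
  obtain ⟨hd, hb2⟩ := hx hy
  set y := 1 - x with hydef
  have hxy : x = 1 - y := by rw [hydef, sub_sub_cancel]
  have hsr0 : 0 < s t + r t := by linarith
  rw [hxy, Real.norm_eq_abs, betaFn_stationaryProfile hp0 hF0 hy,
    betaFn_transported (Real.exp_pos t) hs hsr0 (hT.eq_profile t ht) hy
      (hg.pos _ (moebius_pos hs hsr0 (Ioo_subset_Ioc_self hy))) hd]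
  have h1 := hg.abs_beta_sub_le hα hL hp0 hlog hs hr hsr hy hb2
  have h2 := abs_powerBeta_sub_le hp0 (show 0 ≤ r t / s t by positivity) hF0
    (Ioo_subset_Ioc_self hy)
  have h3 : |p * powerBeta p (r t / s t) y - p * powerBeta p F y| ≤ C₂ * C * X := by
    rw [← mul_sub, abs_mul, abs_of_pos hp0]
    have h4 : |r t / s t - F| ≤ C := hFt.trans (by nlinarith)
    calc p * |powerBeta p (r t / s t) y - powerBeta p F y|
        ≤ p * ((2 * p + 1) * |r t / s t - F| * Real.exp ((2 * p + 1) * |r t / s t - F|)) := by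
          gcongr
      _ ≤ p * ((2 * p + 1) * (C * X) * Real.exp ((2 * p + 1) * C)) := by gcongr
      _ = C₂ * C * X := by rw [hC₂]; ring
  have h5 : C₁ * (1 / (s t + r t)) ^ α ≤ C₁ * C * X := by
    rw [mul_assoc C₁]; exact mul_le_mul_of_nonneg_left hmt hC₁0.le
  refine (abs_sub_le _ (p * powerBeta p (r t / s t) y) _).trans ?_
  have h6 := h1.trans h5
  have h7 : 0 < C * X := by positivity
  linarith
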